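/- Let $d \in \mathbf N$ and let $s,t>0$ satisfy $s+t>1$. For $h>0$ and $f \in C^\infty(\mathbf R^d)$ put $\|f\|_h = \sup \frac{|x^\alpha \partial^\beta f(x)|}{h^{|\alpha+\beta|}\,\alpha!^t\,\beta!^s}$, with supremum over $x \in \mathbf R^d$ and $\alpha,\beta \in \mathbf N^d$. Let $\Sigma_t^s(\mathbf R^d)$ be the space of all $f \in C^\infty(\mathbf R^d)$ with $\|f\|_h<\infty$ for every $h>0$, with the topology defined by the seminorms $\|\cdot\|_h$, $h>0$. Let $(\Sigma_t^s)'(\mathbf R^d)$ be its topological dual. The action of $u \in (\Sigma_t^s)'(\mathbf R^d)$ on $\varphi \in \Sigma_t^s(\mathbf R^d)$ is written $(u,\varphi)$ and is taken conjugate linear in $\varphi$, consistently with $(f,\varphi) = \int f \overline{\varphi}\,dx$ for functions. Fix a window $\psi \in \Sigma_t^s(\mathbf R^d)\setminus 0$ and define, for $u \in (\Sigma_t^s)'(\mathbf R^d)$, $$V_\psi u(x,\xi) = (2\pi)^{-d/2}\,(u, M_\xi T_x \psi), \qquad M_\xi T_x\psi(y) = e^{i\langle y,\xi\rangle}\psi(y-x),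 \qquad x,\xi \in \mathbf R^d.$$ The $t,s$-Gelfand--Shilov wave front set $\mathrm{WF}^{t,s}(u) \subseteq (\mathbf R^d\times\mathbf R^d) \setminus 0$ is defined as follows: a point $(x_0,\xi_0) \neq 0$ satisfies $(x_0,\xi_0) \notin \mathrm{WF}^{t,s}(u)$ if and only if there is an open set $U \subseteq (\mathbf R^d\times \mathbf R^d)\setminus 0$ containing $(x_0,\xi_0)$ such that $$\sup_{\lambda>0,\ (x,\xi)\in U} e^{r\lambda}\,|V_\psi u(\lambda^t x,\lambda^s \xi)| < \infty \qquad \text{for all } r>0.$$ Proposition. Let $u \in (\Sigma_t^s)'(\mathbf R^d)$. If $$\mathrm{WF}^{t,s}(u) \cap \big(\{0\}\times(\mathbf R^d\setminus 0)\big) = \emptyset,$$ then $u \in C^\infty(\mathbf R^d)$, that is, there is a function $f \in C^\infty(\mathbf R^d)$ such that $(u,\varphi) = \int_{\mathbf R^d} f(x)\,\overline{\varphi(x)}\,dx$, with absolutely convergent integral, for all $\varphi \in \Sigma_t^s(\mathbf R^d)$; and, with $u$ identified with $f$, there exist $C,r>0$ such that $$|\partial^\alpha u(x)| \leqslant C^{1+|\alpha|}\,\alpha!^s\,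 e^{r|x|^{1/t}}, \qquad x \in \mathbf R^d,\ \alpha \in \mathbf N^d.$$ -/

import Mathlib

open scoped ContDiff

noncomputable section

namespace GS

/-- Euclidean space `ℝ^d` with the Euclidean norm. Phase space `T^*ℝ^d` is `Rd d × Rd d`. -/
abbrev Rd (d : ℕ) : Type := EuclideanSpace ℝ (Fin d)

variable {d : ℕ}

/-! ### Multi-index notation -/

/-- The length `|α| = α₁ + ⋯ + α_d`. -/
def mlen (α : Fin d → ℕ) : ℕ := ∑ i, α i

/-- The factorial `α! = α₁! ⋯ α_d!`. -/
def mfact (α : Fin d → ℕ) : ℕ := ∏ i, (α i).factorial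

/-- The monomial `x^α = x₁^α₁ ⋯ x_d^α_d`. -/
def monom (α : Fin d → ℕ) (x : Rd d) : ℝ := ∏ i, x i ^ α i

/-- The partial derivative `∂_i f`. -/
def pd (i : Fin d) (f : Rd d → ℂ) : Rd d → ℂ :=
  fun x => fderiv ℝ f x (EuclideanSpace.single i (1 : ℝ))

/-- The composition of the `∂_i^{β_i}` over the indices `i` in a list. -/
def pdList (l : List (Fin d)) (β : Fin d → ℕ) (f : Rd d → ℂ) : Rd d → ℂ :=
  l.foldr (fun i g => (pd i)^[β i] g) f

/-- The partial derivative `∂^β f = ∂₁^β₁ ⋯ ∂_d^β_d f`. -/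
def pderiv (β : Fin d → ℕ) (f : Rd d → ℂ) : Rd d → ℂ :=
  pdList (List.finRange d) β f

/-! ### Elementary facts on partial derivatives of smooth functions -/

lemma contDiff_pd {f : Rd d → ℂ} (hf : ContDiff ℝ ∞ f) (i : Fin d) : ContDiff ℝ ∞ (pd i f) :=
  (hf.fderiv_right (m := ∞) (by simp)).clm_apply contDiff_const

lemma contDiff_pd_iterate {f : Rd d → ℂ} (hf : ContDiff ℝ ∞ f) (i : Fin d) (n : ℕ) :
    ContDiff ℝ ∞ ((pd i)^[n] f) := by
  induction n with
  | zero => exact hf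
  | succ n ih => rw [Function.iterate_succ_apply']; exact contDiff_pd ih i

lemma contDiff_pdList {f : Rd d → ℂ} (hf : ContDiff ℝ ∞ f) (l : List (Fin d)) (β : Fin d → ℕ) :
    ContDiff ℝ ∞ (pdList l β f) := by
  induction l with
  | nil => exact hf
  | cons i l ih => exact contDiff_pd_iterate ih i _

lemma pd_add {f g : Rd d → ℂ} (hf : ContDiff ℝ ∞ f) (hg : ContDiff ℝ ∞ g) (i : Fin d) :
    pd i (f + g) = pd i f + pd i g := by
  funext x
  simp [pd, fderiv_add (hf.differentiable (by simp) x) (hg.differentiable (by simp) x)]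

lemma pd_smul {f : Rd d → ℂ} (c : ℂ) (hf : ContDiff ℝ ∞ f) (i : Fin d) :
    pd i (c • f) = c • pd i f := by
  funext x
  simp [pd, fderiv_const_smul (hf.differentiable (by simp) x)]

lemma pd_iterate_add {f g : Rd d → ℂ} (hf : ContDiff ℝ ∞ f) (hg : ContDiff ℝ ∞ g) (i : Fin d)
    (n : ℕ) : (pd i)^[n] (f + g) = (pd i)^[n] f + (pd i)^[n] g := by
  induction n with
  | zero => rfl
  | succ n ih =>
    simp only [Function.iterate_succ_apply', ih]
    exact pd_add (contDiff_pd_iterate hf i n) (contDiff_pd_iterate hg i n) i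

lemma pd_iterate_smul {f : Rd d → ℂ} (c : ℂ) (hf : ContDiff ℝ ∞ f) (i : Fin d)
    (n : ℕ) : (pd i)^[n] (c • f) = c • (pd i)^[n] f := by
  induction n with
  | zero => rfl
  | succ n ih =>
    simp only [Function.iterate_succ_apply', ih]
    exact pd_smul c (contDiff_pd_iterate hf i n) i

lemma pderiv_add {f g : Rd d → ℂ} (hf : ContDiff ℝ ∞ f) (hg : ContDiff ℝ ∞ g) (β : Fin d → ℕ) :
    pderiv β (f + g) = pderiv β f + pderiv β g := by
  unfold pderiv
  induction List.finRange d with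
  | nil => rfl
  | cons i l ih =>
    simp only [pdList, List.foldr_cons] at ih ⊢
    rw [ih]
    exact pd_iterate_add (contDiff_pdList hf l β) (contDiff_pdList hg l β) i _

lemma pderiv_smul {f : Rd d → ℂ} (c : ℂ) (hf : ContDiff ℝ ∞ f) (β : Fin d → ℕ) :
    pderiv β (c • f) = c • pderiv β f := by
  unfold pderiv
  induction List.finRange d with
  | nil => rfl
  | cons i l ih =>
    simp only [pdList, List.foldr_cons] at ih ⊢
    rw [ih]
    exact pd_iterate_smul c (contDiff_pdList hf l β) i _

lemma pd_comm {f : Rd d → ℂ} (hf : ContDiff ℝ ∞ f) (i j : Fin d) :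
    pd i (pd j f) = pd j (pd i f) := by
  have hd : Differentiable ℝ (fderiv ℝ f) :=
    (hf.fderiv_right (m := ∞) (by simp)).differentiable (by simp)
  have key : ∀ (i j : Fin d) (x : Rd d), pd i (pd j f) x =
      fderiv ℝ (fderiv ℝ f) x (EuclideanSpace.single i (1 : ℝ))
        (EuclideanSpace.single j (1 : ℝ)) := by
    intro i j x
    have h := (hd x).hasFDerivAt.clm_apply
      (hasFDerivAt_const (EuclideanSpace.single j (1 : ℝ)) x)
    have h2 : fderiv ℝ (pd j f) x = _ := h.fderiv
    simp [pd] at h2 ⊢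
    rw [h2]
    simp
  funext x
  rw [key i j, key j i]
  have h2 : (2 : WithTop ℕ∞) ≤ ∞ := WithTop.coe_le_coe.2 (le_top : (2 : ℕ∞) ≤ ⊤)
  exact (hf.contDiffAt.isSymmSndFDerivAt (by simpa using h2)) _ _

lemma pd_iterate_comm {f : Rd d → ℂ} (hf : ContDiff ℝ ∞ f) (i j : Fin d) (m n : ℕ) :
    (pd i)^[m] ((pd j)^[n] f) = (pd j)^[n] ((pd i)^[m] f) := by
  have h1 : ∀ (n : ℕ) (g : Rd d → ℂ), ContDiff ℝ ∞ g →
      pd i ((pd j)^[n] g) = (pd j)^[n] (pd i g) := by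
    intro n
    induction n with
    | zero => intro g _; rfl
    | succ n ih =>
      intro g hg
      rw [Function.iterate_succ_apply, Function.iterate_succ_apply, ih _ (contDiff_pd hg j),
        pd_comm hg]
  induction m with
  | zero => rfl
  | succ m ih =>
    rw [Function.iterate_succ_apply', Function.iterate_succ_apply', ih,
      h1 n _ (contDiff_pd_iterate hf i m)]

lemma pdList_update_of_notMem (j : Fin d) (k : ℕ) (β : Fin d → ℕ) (f : Rd d → ℂ)
    (l : List (Fin d)) (hl : j ∉ l) : pdList l (Function.update β j k) f = pdList l β f := by
  induction l with
  | nil => rfl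
  | cons i l ih =>
    simp only [List.mem_cons, not_or] at hl
    have := ih hl.2
    simp only [pdList, List.foldr_cons] at this ⊢
    rw [this, Function.update_of_ne (Ne.symm hl.1)]

lemma pdList_split (j : Fin d) (β : Fin d → ℕ) {f : Rd d → ℂ} (hf : ContDiff ℝ ∞ f)
    (l : List (Fin d)) (hl : l.Nodup) (hj : j ∈ l) :
    pdList l β f = (pd j)^[β j] (pdList l (Function.update β j 0) f) := by
  induction l with
  | nil => simp at hj
  | cons i l ih =>
    rw [List.nodup_cons] at hl
    by_cases hij : i = j
    · subst hij
      have := pdList_update_of_notMem i 0 β f l hl.1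
      simp only [pdList, List.foldr_cons, Function.update_self] at this ⊢
      rw [this]
      rfl
    · have hj' : j ∈ l := by
        rcases List.mem_cons.1 hj with h | h
        · exact absurd h.symm hij
        · exact h
      have := ih hl.2 hj'
      have hc := contDiff_pdList hf l (Function.update β j 0)
      simp only [pdList, List.foldr_cons] at this hc ⊢
      rw [this, Function.update_of_ne hij, pd_iterate_comm hc]

lemma pderiv_split (j : Fin d) (β : Fin d → ℕ) {f : Rd d → ℂ} (hf : ContDiff ℝ ∞ f) :
    pderiv β f = (pd j)^[β j] (pderiv (Function.update β j 0) f) :=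
  pdList_split j β hf _ (List.nodup_finRange d) (List.mem_finRange j)

lemma contDiff_pderiv {f : Rd d → ℂ} (hf : ContDiff ℝ ∞ f) (β : Fin d → ℕ) :
    ContDiff ℝ ∞ (pderiv β f) := contDiff_pdList hf _ β

/-! ### The space `Σ_t^s(ℝ^d)` -/

/-- The quotient `|x^α ∂^β f(x)| / (h^{|α+β|} α!^t β!^s)`. -/
def gsQuot (t s h : ℝ) (f : Rd d → ℂ) (p : (Fin d → ℕ) × (Fin d → ℕ) × Rd d) : ℝ :=
  |monom p.1 p.2.2| * ‖pderiv p.2.1 f p.2.2‖ /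
    (h ^ (mlen p.1 + mlen p.2.1) * (mfact p.1 : ℝ) ^ t * (mfact p.2.1 : ℝ) ^ s)

/-- `f ∈ Σ_t^s(ℝ^d)`: `f` is smooth and, for every `h > 0`, the supremum of
`|x^α ∂^β f(x)| / (h^{|α+β|} α!^t β!^s)` over all `α, β, x` is finite. -/
def IsGS (t s : ℝ) (f : Rd d → ℂ) : Prop :=
  ContDiff ℝ ∞ f ∧ ∀ h : ℝ, 0 < h → BddAbove (Set.range (gsQuot t s h f))

lemma mfact_pos (α : Fin d → ℕ) : 0 < mfact α := Finset.prod_pos fun _ _ => Nat.factorial_pos _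

lemma gsDenom_pos (t s : ℝ) {h : ℝ} (hh : 0 < h) (α β : Fin d → ℕ) :
    0 < h ^ (mlen α + mlen β) * (mfact α : ℝ) ^ t * (mfact β : ℝ) ^ s := by
  have h1 : (0 : ℝ) < mfact α := by exact_mod_cast mfact_pos α
  have h2 : (0 : ℝ) < mfact β := by exact_mod_cast mfact_pos β
  positivity

lemma gsQuot_nonneg (t s : ℝ) {h : ℝ} (hh : 0 < h) (f : Rd d → ℂ) (p) :
    0 ≤ gsQuot t s h f p :=
  div_nonneg (by positivity) (gsDenom_pos t s hh _ _).le

lemma gsQuot_add_le (t s : ℝ) {h : ℝ} (hh : 0 < h) {f g : Rd d → ℂ} (hf : ContDiff ℝ ∞ f)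
    (hg : ContDiff ℝ ∞ g) (p) :
    gsQuot t s h (f + g) p ≤ gsQuot t s h f p + gsQuot t s h g p := by
  unfold gsQuot
  rw [← add_div, ← mul_add, pderiv_add hf hg]
  have := (gsDenom_pos t s hh p.1 p.2.1).le
  gcongr
  exact norm_add_le _ _

lemma gsQuot_smul (t s h : ℝ) {f : Rd d → ℂ} (c : ℂ) (hf : ContDiff ℝ ∞ f) (p) :
    gsQuot t s h (c • f) p = ‖c‖ * gsQuot t s h f p := by
  unfold gsQuot
  rw [pderiv_smul c hf, Pi.smul_apply, norm_smul]
  ring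

/-- `Σ_t^s(ℝ^d)` as a linear subspace of the space of all functions. -/
def gsSubmodule (d : ℕ) (t s : ℝ) : Submodule ℂ (Rd d → ℂ) where
  carrier := {f | IsGS t s f}
  add_mem' := by
    rintro f g ⟨hf, hf'⟩ ⟨hg, hg'⟩
    refine ⟨hf.add hg, fun h hh => ?_⟩
    obtain ⟨A, hA⟩ := hf' h hh
    obtain ⟨B, hB⟩ := hg' h hh
    refine ⟨A + B, ?_⟩
    rintro _ ⟨p, rfl⟩
    exact (gsQuot_add_le t s hh hf hg p).trans (add_le_add (hA ⟨p, rfl⟩) (hB ⟨p, rfl⟩))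
  zero_mem' := by
    have h0 : ContDiff ℝ ∞ (0 : Rd d → ℂ) := contDiff_const
    refine ⟨h0, fun h hh => ⟨0, ?_⟩⟩
    rintro _ ⟨p, rfl⟩
    have := gsQuot_smul t s h 0 h0 p
    simp only [zero_smul, norm_zero, zero_mul] at this
    exact this.le
  smul_mem' := by
    rintro c f ⟨hf, hf'⟩
    refine ⟨contDiff_const.smul hf, fun h hh => ?_⟩
    obtain ⟨A, hA⟩ := hf' h hh
    refine ⟨‖c‖ * A, ?_⟩
    rintro _ ⟨p, rfl⟩
    rw [gsQuot_smul t s h c hf p]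
    exact mul_le_mul_of_nonneg_left (hA ⟨p, rfl⟩) (norm_nonneg c)

/-- The Gelfand–Shilov space `Σ_t^s(ℝ^d)` of Beurling type. (This is a type of its own, so that it
does not inherit the topology of pointwise convergence.) -/
def GelfandShilov (d : ℕ) (t s : ℝ) : Type := gsSubmodule d t s

variable {t s : ℝ}

instance : AddCommGroup (GelfandShilov d t s) := inferInstanceAs (AddCommGroup (gsSubmodule d t s))

instance : Module ℂ (GelfandShilov d t s) := inferInstanceAs (Module ℂ (gsSubmodule d t s))

instance : CoeFun (GelfandShilov d t s) (fun _ => Rd d → ℂ) := ⟨fun f => f.1⟩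

/-- The norm `‖f‖_h = sup |x^α ∂^β f(x)| / (h^{|α+β|} α!^t β!^s)`, as a seminorm on
`Σ_t^s(ℝ^d)`, for each `h > 0`. -/
def gsSeminorm (d : ℕ) (t s : ℝ) : SeminormFamily ℂ (GelfandShilov d t s) {h : ℝ // 0 < h} :=
  fun h => Seminorm.of (fun f => ⨆ p, gsQuot t s h.1 (f : Rd d → ℂ) p)
    (by
      rintro ⟨f, hf⟩ ⟨g, hg⟩
      refine ciSup_le fun p => ?_
      refine (gsQuot_add_le t s h.2 hf.1 hg.1 p).trans ?_
      exact add_le_add (le_ciSup (hf.2 h.1 h.2) p) (le_ciSup (hg.2 h.1 h.2) p))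
    (by
      rintro c ⟨f, hf⟩
      have : ∀ p, gsQuot t s h.1 (c • f) p = ‖c‖ * gsQuot t s h.1 f p :=
        fun p => gsQuot_smul t s h.1 c hf.1 p
      calc (⨆ p, gsQuot t s h.1 (c • f) p) = ⨆ p, ‖c‖ * gsQuot t s h.1 f p := by simp_rw [this]
        _ = ‖c‖ * ⨆ p, gsQuot t s h.1 f p := (Real.mul_iSup_of_nonneg (norm_nonneg c) _).symm)

instance : Nonempty {h : ℝ // 0 < h} := ⟨⟨1, one_pos⟩⟩

/-- The Fréchet topology of `Σ_t^s(ℝ^d)`, defined by the seminorms `‖·‖_h`, `h > 0`. -/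
instance : TopologicalSpace (GelfandShilov d t s) := (gsSeminorm d t s).moduleFilterBasis.topology

lemma withSeminorms_gs : WithSeminorms (gsSeminorm d t s) := ⟨rfl⟩

/-- The space `(Σ_t^s)'(ℝ^d)` of Gelfand–Shilov ultradistributions. An ultradistribution `u` is a
continuous functional `φ ↦ (u, φ)`, which by convention is conjugate linear, consistent with
the `L²` inner product that is conjugate linear in the second argument. -/
abbrev Ultradistribution (d : ℕ) (t s : ℝ) : Type := GelfandShilov d t s →L⋆[ℂ] ℂ

/-- The ultradistribution `u` is (given by) the function `f`:
`(u, φ) = ∫ f(x) \overline{φ(x)} dx`, with absolutely convergent integrals,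
for all `φ ∈ Σ_t^s(ℝ^d)`. -/
def IsGivenBy (u : Ultradistribution d t s) (f : Rd d → ℂ) : Prop :=
  ∀ φ : GelfandShilov d t s,
    MeasureTheory.Integrable (fun x => f x * starRingEnd ℂ (φ x)) ∧
      u φ = ∫ x, f x * starRingEnd ℂ (φ x)

/-! ### Invariance of `Σ_t^s(ℝ^d)` under translation and modulation -/

/-- Translation `T_x f(y) = f(y - x)`. -/
def translate (x : Rd d) (f : Rd d → ℂ) : Rd d → ℂ := fun y => f (y - x)

/-- Modulation `M_ξ f(y) = e^{i⟨y, ξ⟩} f(y)`. -/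
def modulate (ξ : Rd d) (f : Rd d → ℂ) : Rd d → ℂ :=
  fun y => Complex.exp (Complex.I * ((inner ℝ y ξ : ℝ) : ℂ)) * f y

lemma isGS_iff {f : Rd d → ℂ} : IsGS t s f ↔ ContDiff ℝ ∞ f ∧ ∀ h : ℝ, 0 < h →
    ∃ C : ℝ, 0 ≤ C ∧ ∀ α β x, |monom α x| * ‖pderiv β f x‖ ≤
      C * (h ^ (mlen α + mlen β) * (mfact α : ℝ) ^ t * (mfact β : ℝ) ^ s) := by
  refine and_congr_right fun _ => forall₂_congr fun h hh => ⟨?_, ?_⟩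
  · rintro ⟨C, hC⟩
    refine ⟨C, (gsQuot_nonneg t s hh f (0, 0, 0)).trans (hC ⟨_, rfl⟩), fun α β x => ?_⟩
    exact (div_le_iff₀ (gsDenom_pos t s hh α β)).1 (hC ⟨(α, β, x), rfl⟩)
  · rintro ⟨C, _, hC⟩
    refine ⟨C, ?_⟩
    rintro _ ⟨⟨α, β, x⟩, rfl⟩
    exact (div_le_iff₀ (gsDenom_pos t s hh α β)).2 (hC α β x)

lemma pow_le_factorial_rpow {h a : ℝ} (hh : 0 < h) (hs : 0 < s) (ha : 0 ≤ a) :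
    ∃ C : ℝ, 0 ≤ C ∧ ∀ m : ℕ, a ^ m ≤ C * (h ^ m * (m.factorial : ℝ) ^ s) := by
  refine ⟨(Real.exp ((a / h) ^ (1 / s))) ^ s, by positivity, fun m => ?_⟩
  have hf : (0 : ℝ) < m.factorial := by exact_mod_cast m.factorial_pos
  have h0 : 0 ≤ a / h := by positivity
  have h1 := Real.pow_div_factorial_le_exp (x := (a / h) ^ (1 / s)) (by positivity) m
  rw [div_le_iff₀ hf] at h1
  have h2 := Real.rpow_le_rpow (by positivity) h1 hs.le
  rw [Real.mul_rpow (by positivity) hf.le] at h2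
  have h3 : (((a / h) ^ (1 / s)) ^ m) ^ s = (a / h) ^ m := by
    rw [← Real.rpow_natCast, ← Real.rpow_mul h0, ← Real.rpow_mul h0, ← Real.rpow_natCast]
    congr 1
    field_simp
  rw [h3, div_pow, div_le_iff₀ (by positivity)] at h2
  linarith

lemma sum_choose_le {a A B q : ℝ} (hq : 0 ≤ q) (hA : 0 ≤ A) (hB : 0 ≤ B) (ha : 0 ≤ a)
    (hs : 0 < s) (b : ℕ → ℝ)
    (h1 : ∀ k, b k ≤ A * (q ^ k * (k.factorial : ℝ) ^ s))
    (h2 : ∀ m, a ^ m ≤ B * (q ^ m * (m.factorial : ℝ) ^ s)) (n : ℕ) :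
    ∑ ij ∈ Finset.HasAntidiagonal.antidiagonal n, n.choose ij.1 • (a ^ ij.1 * b ij.2) ≤
      B * A * ((2 * q) ^ n * (n.factorial : ℝ) ^ s) := by
  have key : ∀ ij ∈ Finset.HasAntidiagonal.antidiagonal n, n.choose ij.1 • (a ^ ij.1 * b ij.2) ≤
      n.choose ij.1 • (B * A * (q ^ n * (n.factorial : ℝ) ^ s)) := by
    rintro ⟨i, j⟩ hij
    rw [Finset.HasAntidiagonal.mem_antidiagonal] at hij
    simp only at hij
    subst hij
    refine nsmul_le_nsmul_right ?_ _
    have hfac : ((i.factorial : ℝ)) ^ s * (j.factorial : ℝ) ^ s ≤ ((i + j).factorial : ℝ) ^ s := by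
      rw [← Real.mul_rpow (by positivity) (by positivity)]
      refine Real.rpow_le_rpow (by positivity) ?_ hs.le
      exact_mod_cast Nat.le_of_dvd (Nat.factorial_pos _) (Nat.factorial_mul_factorial_dvd_factorial_add i j)
    calc a ^ i * b j ≤ a ^ i * (A * (q ^ j * (j.factorial : ℝ) ^ s)) := by
          gcongr; exact h1 j
      _ ≤ (B * (q ^ i * (i.factorial : ℝ) ^ s)) * (A * (q ^ j * (j.factorial : ℝ) ^ s)) := by
          gcongr; exact h2 i
      _ = B * A * (q ^ (i + j) * ((i.factorial : ℝ) ^ s * (j.factorial : ℝ) ^ s)) := by ring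
      _ ≤ _ := by gcongr
  refine (Finset.sum_le_sum key).trans (le_of_eq ?_)
  rw [← Finset.sum_smul, Finset.Nat.sum_antidiagonal_eq_sum_range_succ_mk]
  simp only [Nat.sum_range_choose, nsmul_eq_mul]
  push_cast
  ring

lemma mlen_update (j : Fin d) (k : ℕ) (α : Fin d → ℕ) :
    mlen (Function.update α j k) = k + mlen (Function.update α j 0) := by
  simp [mlen, Finset.sum_update_of_mem]

lemma mfact_update (j : Fin d) (k : ℕ) (α : Fin d → ℕ) :
    mfact (Function.update α j k) = k.factorial * mfact (Function.update α j 0) := by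
  unfold mfact
  have : ∀ k, ∏ i, (Function.update α j k i).factorial =
      ∏ i, Function.update (fun i => (α i).factorial) j k.factorial i := by
    intro k
    refine Finset.prod_congr rfl fun i _ => ?_
    by_cases h : i = j
    · subst h; simp
    · simp [h]
  simp [this, Finset.prod_update_of_mem]

lemma monom_split (j : Fin d) (k : ℕ) (α : Fin d → ℕ) (x : Rd d) :
    monom (Function.update α j k) x = x j ^ k * monom (Function.update α j 0) x := by
  unfold monom
  have : ∀ k, ∏ i, x i ^ (Function.update α j k i) =
      ∏ i, Function.update (fun i => x i ^ α i) j (x j ^ k) i := by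
    intro k
    refine Finset.prod_congr rfl fun i _ => ?_
    by_cases h : i = j
    · subst h; simp
    · simp [h]
  simp [this, Finset.prod_update_of_mem]

/-- Multiplication by `e^{i c x_j}`. -/
def modCoord (j : Fin d) (c : ℝ) (f : Rd d → ℂ) : Rd d → ℂ :=
  fun x => Complex.exp (Complex.I * ((c * x j : ℝ) : ℂ)) * f x

lemma contDiff_modCoord (j : Fin d) (c : ℝ) {f : Rd d → ℂ} (hf : ContDiff ℝ ∞ f) :
    ContDiff ℝ ∞ (modCoord j c f) := by
  unfold modCoord
  refine ContDiff.mul ?_ hf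
  refine ContDiff.cexp (contDiff_const.mul (Complex.ofRealCLM.contDiff.comp ?_))
  exact contDiff_const.mul (EuclideanSpace.proj (𝕜 := ℝ) j : Rd d →L[ℝ] ℝ).contDiff

lemma norm_modCoord (j : Fin d) (c : ℝ) (f : Rd d → ℂ) (x : Rd d) :
    ‖modCoord j c f x‖ = ‖f x‖ := by
  unfold modCoord
  rw [norm_mul, mul_comm Complex.I, Complex.norm_exp_ofReal_mul_I, one_mul]

lemma pd_modCoord (i j : Fin d) (c : ℝ) {f : Rd d → ℂ} (hf : ContDiff ℝ ∞ f) :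
    pd i (modCoord j c f) = modCoord j c (pd i f) +
      (if i = j then Complex.I * (c : ℂ) else 0) • modCoord j c f := by
  funext x
  have hl : HasFDerivAt (fun x : Rd d => x j) (EuclideanSpace.proj (𝕜 := ℝ) j : Rd d →L[ℝ] ℝ) x :=
    (EuclideanSpace.proj (𝕜 := ℝ) j : Rd d →L[ℝ] ℝ).hasFDerivAt
  have h1 := Complex.ofRealCLM.hasFDerivAt.comp x (hl.const_mul c)
  have h2 := (h1.const_mul Complex.I).cexp
  have h3 := h2.mul (hf.differentiable (by simp) x).hasFDerivAt
  have h4 : fderiv ℝ (modCoord j c f) x = _ := h3.fderiv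
  unfold pd
  rw [h4]
  by_cases hij : i = j
  · subst hij
    simp [modCoord]
    ring
  · have hji : ¬ j = i := fun h => hij h.symm
    simp [modCoord, hij, hji]

lemma pd_iterate_modCoord_ne {i j : Fin d} (hij : i ≠ j) (c : ℝ) {f : Rd d → ℂ}
    (hf : ContDiff ℝ ∞ f) (n : ℕ) :
    (pd i)^[n] (modCoord j c f) = modCoord j c ((pd i)^[n] f) := by
  induction n with
  | zero => rfl
  | succ n ih =>
    rw [Function.iterate_succ_apply', Function.iterate_succ_apply', ih,
      pd_modCoord i j c (contDiff_pd_iterate hf i n)]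
    simp [hij]

lemma pdList_modCoord (j : Fin d) (c : ℝ) {f : Rd d → ℂ} (hf : ContDiff ℝ ∞ f) (β : Fin d → ℕ)
    (hβ : β j = 0) (l : List (Fin d)) :
    pdList l β (modCoord j c f) = modCoord j c (pdList l β f) := by
  induction l with
  | nil => rfl
  | cons i l ih =>
    have hc := contDiff_pdList hf l β
    simp only [pdList, List.foldr_cons] at ih hc ⊢
    rw [ih]
    by_cases hij : i = j
    · subst hij; rw [hβ]; rfl
    · exact pd_iterate_modCoord_ne hij c hc _

lemma norm_pd_iterate_modCoord_le (j : Fin d) (c : ℝ) (x : Rd d) (n : ℕ) :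
    ∀ g : Rd d → ℂ, ContDiff ℝ ∞ g → ‖(pd j)^[n] (modCoord j c g) x‖ ≤
      ∑ ij ∈ Finset.HasAntidiagonal.antidiagonal n, n.choose ij.1 • (|c| ^ ij.1 * ‖(pd j)^[ij.2] g x‖) := by
  induction n with
  | zero => intro g _; simp [norm_modCoord]
  | succ n ih =>
    intro g hg
    rw [Finset.sum_antidiagonal_choose_succ_nsmul (fun i k => |c| ^ i * ‖(pd j)^[k] g x‖) n]
    have hg' := contDiff_modCoord j c hg
    have hg'' : ContDiff ℝ ∞ ((if j = j then Complex.I * (c : ℂ) else 0) • modCoord j c g) :=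
      contDiff_const.smul hg'
    rw [Function.iterate_succ_apply, pd_modCoord j j c hg,
      pd_iterate_add (contDiff_modCoord j c (contDiff_pd hg j)) hg'',
      pd_iterate_smul _ hg']
    refine (norm_add_le _ _).trans (add_le_add ?_ ?_)
    · exact ih _ (contDiff_pd hg j)
    · have h1 := ih g hg
      have h2 : ‖((if j = j then Complex.I * (c : ℂ) else 0) •
          (pd j)^[n] (modCoord j c g)) x‖ = |c| * ‖(pd j)^[n] (modCoord j c g) x‖ := by
        simp
      rw [h2]
      refine (mul_le_mul_of_nonneg_left h1 (abs_nonneg c)).trans (le_of_eq ?_)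
      rw [Finset.mul_sum]
      refine Finset.sum_congr rfl ?_
      rintro ⟨i, k⟩ hik
      rw [n.choose_symm_of_eq_add (Finset.HasAntidiagonal.mem_antidiagonal.1 hik).symm]
      simp only [nsmul_eq_mul]
      ring

lemma isGS_modCoord (hs : 0 < s) (j : Fin d) (c : ℝ) {f : Rd d → ℂ} (hf : IsGS t s f) :
    IsGS t s (modCoord j c f) := by
  rw [isGS_iff] at hf ⊢
  obtain ⟨hf, hb⟩ := hf
  refine ⟨contDiff_modCoord j c hf, fun h hh => ?_⟩
  obtain ⟨A, hA0, hA⟩ := hb (h / 2) (by positivity)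
  obtain ⟨B, hB0, hB⟩ := pow_le_factorial_rpow (s := s) (a := |c|) (half_pos hh) hs (abs_nonneg c)
  refine ⟨B * A, by positivity, fun α β x => ?_⟩
  set β₀ := Function.update β j 0 with hβ₀
  have hβ : ∀ k, pderiv (Function.update β j k) f x = (pd j)^[k] (pderiv β₀ f) x := by
    intro k
    rw [pderiv_split j _ hf]
    simp [hβ₀]
  have hfa : (0 : ℝ) < mfact α := by exact_mod_cast mfact_pos α
  have hfb : (0 : ℝ) < mfact β₀ := by exact_mod_cast mfact_pos β₀
  have hm : mlen β = β j + mlen β₀ := by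
    have := mlen_update j (β j) β
    rwa [Function.update_eq_self] at this
  have hfm : mfact β = (β j).factorial * mfact β₀ := by
    have := mfact_update j (β j) β
    rwa [Function.update_eq_self] at this
  have h1 : ‖pderiv β (modCoord j c f) x‖ ≤
      ∑ ij ∈ Finset.HasAntidiagonal.antidiagonal (β j), (β j).choose ij.1 •
        (|c| ^ ij.1 * ‖(pd j)^[ij.2] (pderiv β₀ f) x‖) := by
    rw [pderiv_split j β (contDiff_modCoord j c hf), pderiv, pdList_modCoord j c hf _ (by simp)]
    exact norm_pd_iterate_modCoord_le j c x (β j) _ (contDiff_pderiv hf β₀)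
  have h2 := sum_choose_le (q := h / 2) (a := |c|) (B := B)
    (A := A * ((h / 2) ^ (mlen α + mlen β₀) * (mfact α : ℝ) ^ t * (mfact β₀ : ℝ) ^ s))
    (by positivity) (by positivity) hB0 (abs_nonneg c) hs
    (fun k => |monom α x| * ‖(pd j)^[k] (pderiv β₀ f) x‖)
    (by
      intro k
      have := hA α (Function.update β j k) x
      rw [hβ, mlen_update, mfact_update] at this
      refine this.trans (le_of_eq ?_)
      push_cast
      rw [Real.mul_rpow (by positivity) (by positivity)]
      ring) hB (β j)
  calc |monom α x| * ‖pderiv β (modCoord j c f) x‖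
      ≤ |monom α x| * ∑ ij ∈ Finset.HasAntidiagonal.antidiagonal (β j), (β j).choose ij.1 •
          (|c| ^ ij.1 * ‖(pd j)^[ij.2] (pderiv β₀ f) x‖) := by gcongr
    _ = ∑ ij ∈ Finset.HasAntidiagonal.antidiagonal (β j), (β j).choose ij.1 •
          (|c| ^ ij.1 * (|monom α x| * ‖(pd j)^[ij.2] (pderiv β₀ f) x‖)) := by
        rw [Finset.mul_sum]
        refine Finset.sum_congr rfl fun _ _ => ?_
        simp only [nsmul_eq_mul]
        ring
    _ ≤ _ := h2
    _ ≤ B * (A * (h ^ (mlen α + mlen β₀) * (mfact α : ℝ) ^ t * (mfact β₀ : ℝ) ^ s)) *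
          ((2 * (h / 2)) ^ (β j) * ((β j).factorial : ℝ) ^ s) := by
        gcongr
        linarith
    _ = _ := by
        rw [hm, hfm]
        push_cast
        rw [Real.mul_rpow (by positivity) (by positivity)]
        ring

lemma pd_translate (i : Fin d) (a : Rd d) (f : Rd d → ℂ) :
    pd i (translate a f) = translate a (pd i f) := by
  funext x
  have h : fderiv ℝ (translate a f) x = fderiv ℝ f (x - a) := fderiv_comp_sub a
  simp only [pd, translate] at h ⊢
  rw [h]

lemma pdList_translate (a : Rd d) (f : Rd d → ℂ) (β : Fin d → ℕ) (l : List (Fin d)) :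
    pdList l β (translate a f) = translate a (pdList l β f) := by
  have hit : ∀ (i : Fin d) (n : ℕ) (g : Rd d → ℂ),
      (pd i)^[n] (translate a g) = translate a ((pd i)^[n] g) := by
    intro i n g
    induction n with
    | zero => rfl
    | succ n ih => rw [Function.iterate_succ_apply', Function.iterate_succ_apply', ih, pd_translate]
  induction l with
  | nil => rfl
  | cons i l ih =>
    simp only [pdList, List.foldr_cons] at ih ⊢
    rw [ih, hit]

lemma isGS_translate_single (ht : 0 < t) (j : Fin d) (a : ℝ) {f : Rd d → ℂ} (hf : IsGS t s f) :
    IsGS t s (translate (EuclideanSpace.single j a) f) := by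
  rw [isGS_iff] at hf ⊢
  obtain ⟨hf, hb⟩ := hf
  refine ⟨hf.comp (contDiff_id.sub contDiff_const), fun h hh => ?_⟩
  obtain ⟨A, hA0, hA⟩ := hb (h / 2) (by positivity)
  obtain ⟨B, hB0, hB⟩ := pow_le_factorial_rpow (s := t) (a := |a|) (half_pos hh) ht (abs_nonneg a)
  refine ⟨B * A, by positivity, fun α β x => ?_⟩
  set α₀ := Function.update α j 0 with hα₀
  set y := x - EuclideanSpace.single j a with hy
  have hfa : (0 : ℝ) < mfact α₀ := by exact_mod_cast mfact_pos α₀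
  have hfb : (0 : ℝ) < mfact β := by exact_mod_cast mfact_pos β
  have hm : mlen α = α j + mlen α₀ := by
    have := mlen_update j (α j) α
    rwa [Function.update_eq_self] at this
  have hfm : mfact α = (α j).factorial * mfact α₀ := by
    have := mfact_update j (α j) α
    rwa [Function.update_eq_self] at this
  have hmon : monom α x = x j ^ (α j) * monom α₀ x := by
    have := monom_split j (α j) α x
    rwa [Function.update_eq_self] at this
  have hxy : x j = a + y j := by simp [hy]
  have hmon₀ : monom α₀ x = monom α₀ y := by
    unfold monom
    refine Finset.prod_congr rfl fun i _ => ?_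
    by_cases hij : i = j
    · subst hij; simp [hα₀]
    · simp [hy, hij]
  have hder : pderiv β (translate (EuclideanSpace.single j a) f) x = pderiv β f y := by
    rw [pderiv, pdList_translate]; rfl
  have h2 := sum_choose_le (q := h / 2) (a := |a|) (B := B)
    (A := A * ((h / 2) ^ (mlen α₀ + mlen β) * (mfact α₀ : ℝ) ^ t * (mfact β : ℝ) ^ s))
    (by positivity) (by positivity) hB0 (abs_nonneg a) ht
    (fun k => |y j| ^ k * (|monom α₀ y| * ‖pderiv β f y‖))
    (by
      intro k
      have := hA (Function.update α j k) β y
      rw [monom_split, mlen_update, mfact_update, abs_mul, abs_pow] at this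
      rw [← mul_assoc]
      refine this.trans (le_of_eq ?_)
      push_cast
      rw [Real.mul_rpow (by positivity) (by positivity)]
      ring) hB (α j)
  calc |monom α x| * ‖pderiv β (translate (EuclideanSpace.single j a) f) x‖
      = |a + y j| ^ (α j) * (|monom α₀ y| * ‖pderiv β f y‖) := by
        rw [hder, hmon, hmon₀, hxy, abs_mul, abs_pow]; ring
    _ ≤ (|a| + |y j|) ^ (α j) * (|monom α₀ y| * ‖pderiv β f y‖) := by
        gcongr
        exact abs_add_le _ _
    _ = ∑ ij ∈ Finset.HasAntidiagonal.antidiagonal (α j), (α j).choose ij.1 •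
          (|a| ^ ij.1 * (|y j| ^ ij.2 * (|monom α₀ y| * ‖pderiv β f y‖))) := by
        rw [(Commute.all (|a|) (|y j|)).add_pow', Finset.sum_mul]
        refine Finset.sum_congr rfl fun _ _ => ?_
        simp only [nsmul_eq_mul]
        ring
    _ ≤ _ := h2
    _ ≤ B * (A * (h ^ (mlen α₀ + mlen β) * (mfact α₀ : ℝ) ^ t * (mfact β : ℝ) ^ s)) *
          ((2 * (h / 2)) ^ (α j) * ((α j).factorial : ℝ) ^ t) := by
        gcongr
        linarith
    _ = _ := by
        rw [hm, hfm]
        push_cast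
        rw [Real.mul_rpow (by positivity) (by positivity)]
        ring

lemma isGS_translate (ht : 0 < t) (x : Rd d) {f : Rd d → ℂ} (hf : IsGS t s f) :
    IsGS t s (translate x f) := by
  have key : ∀ S : Finset (Fin d),
      IsGS t s (translate (∑ j ∈ S, EuclideanSpace.single j (x j)) f) := by
    intro S
    induction S using Finset.induction_on with
    | empty =>
      have h0 : translate (0 : Rd d) f = f := by funext y; simp [translate]
      rwa [Finset.sum_empty, h0]
    | insert j S hj ih =>
      have := isGS_translate_single ht j (x j) ih
      convert this using 1
      funext y
      simp [translate, Finset.sum_insert hj, sub_sub]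
  have hx : (∑ j, EuclideanSpace.single j (x j) : Rd d) = x := by
    ext i
    simp [Finset.sum_apply, Pi.single_apply]
  have := key Finset.univ
  rwa [hx] at this

lemma isGS_modulate (hs : 0 < s) (ξ : Rd d) {f : Rd d → ℂ} (hf : IsGS t s f) :
    IsGS t s (modulate ξ f) := by
  have key : ∀ S : Finset (Fin d),
      IsGS t s (fun y => Complex.exp (Complex.I * ((∑ j ∈ S, ξ j * y j : ℝ) : ℂ)) * f y) := by
    intro S
    induction S using Finset.induction_on with
    | empty => simpa using hf
    | insert j S hj ih =>
      have := isGS_modCoord hs j (ξ j) ih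
      convert this using 1
      funext y
      rw [Finset.sum_insert hj]
      simp only [modCoord]
      rw [← mul_assoc, ← Complex.exp_add]
      push_cast
      ring_nf
  have := key Finset.univ
  convert this using 1
  funext y
  simp [modulate, PiLp.inner_apply, mul_comm]

/-- The time-frequency shift `M_ξ T_x φ ∈ Σ_t^s(ℝ^d)` of `φ ∈ Σ_t^s(ℝ^d)`, for `t, s > 0`. -/
def tfShift (ht : 0 < t) (hs : 0 < s) (x ξ : Rd d) (φ : GelfandShilov d t s) :
    GelfandShilov d t s :=
  ⟨modulate ξ (translate x φ), isGS_modulate hs ξ (isGS_translate ht x φ.2)⟩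

/-! ### The short-time Fourier transform and the wave front set -/

/-- The short-time Fourier transform `V_ψ u(x, ξ) = (2π)^{-d/2} (u, M_ξ T_x ψ)`. -/
def stft (ht : 0 < t) (hs : 0 < s) (ψ : GelfandShilov d t s) (u : Ultradistribution d t s)
    (x ξ : Rd d) : ℂ :=
  (((2 * Real.pi) ^ (-(d : ℝ) / 2) : ℝ) : ℂ) * u (tfShift ht hs x ξ ψ)

/-- The `t,s`-Gelfand–Shilov wave front set `WF^{t,s}(u)`, computed with the window `ψ`:
`z₀ ∈ T^*ℝ^d ∖ 0` does not belong to it iff there is an open set `U ⊆ T^*ℝ^d ∖ 0` containing `z₀`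
such that `sup_{λ > 0, (x, ξ) ∈ U} e^{rλ} |V_ψ u(λ^t x, λ^s ξ)| < ∞` for every `r > 0`. -/
def waveFrontSet (ht : 0 < t) (hs : 0 < s) (ψ : GelfandShilov d t s)
    (u : Ultradistribution d t s) : Set (Rd d × Rd d) :=
  {z₀ | z₀ ≠ 0 ∧ ¬ ∃ U : Set (Rd d × Rd d), IsOpen U ∧ 0 ∉ U ∧ z₀ ∈ U ∧
    ∀ r : ℝ, 0 < r → ∃ C : ℝ, ∀ lam : ℝ, 0 < lam → ∀ z ∈ U,
      Real.exp (r * lam) * ‖stft ht hs ψ u (lam ^ t • z.1) (lam ^ s • z.2)‖ ≤ C}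

end GS

end

noncomputable section

namespace GS

open MeasureTheory

variable {d : ℕ} {t s : ℝ}

/-! ### Elementary inequalities -/

/-! The proof is time-frequency synthesis. Up to the factor (2π)^d ‖ψ‖² (`gaborConst`), u is the
superposition of the shifts M_ξ T_x ψ with density G(x, ξ) = (u, M_ξ T_x ψ). Smoothness and growth
of u can be read off from this integral as soon as G decays in ξ.

Decay of G. Continuity of u gives |G| ≤ C exp(r₀(|x|^{1/t} + |ξ|^{1/s})). A point with ξ ≠ 0 is (λ^t
x', λ^s ξ') with λ = |ξ|^{1/s} and |ξ'| = 1. The wave front hypothesis and compactness of the sphere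
give decay e^{-rλ} where |x'| < ε. Where |x'| ≥ ε, λ is at most a multiple of |x|^{1/t}, so the a
priori bound costs growth in x only. Hence for each r there is R with |G| ≤ C exp(-r|ξ|^{1/s} +
R|x|^{1/t}) (`exists_norm_tfShift_le_of_waveFrontSet`).

Synthesis. The β-th derivative of M_ξ T_x ψ at y is at most C (2^d)^{|β|} β!^s exp(sd|ξ|^{1/s} -
a|y-x|^{1/t}), where a is arbitrary while the frequency rate sd is fixed
(`GelfandShilov.exists_norm_pderiv_tfFun_le`). So r = sd + 1 can be fixed first, which determines R,
and a can be chosen afterwards to beat R. All differentiated integrals then converge and obey the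
required bounds (`synth_tfFun`).

Identification with u. What is needed is that u may be interchanged with the integral. This is done
by duality, without integrating in Σ_t^s. The inversion formula for test functions
(`GelfandShilov.synth_gabor`) bounds their norms by weighted L¹, hence weighted L², norms of their
Gabor transforms. So Hahn–Banach and Riesz give (u, φ) = ∫ H \overline{W φ} with H in L² and W the
weighted Gabor transform (`Ultradistribution.exists_eq_integral_conj_gabor`). Inserting the
reproducing formula for φ and applying Fubini replaces H by G
(`Ultradistribution.integral_conj_gabor_mul`), and one more use of Fubini gives `isGivenBy_synth`.
-/

lemma add_rpow_le_two_rpow_mul {a b p : ℝ} (ha : 0 ≤ a) (hb : 0 ≤ b) (hp : 0 ≤ p) :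
    (a + b) ^ p ≤ 2 ^ p * (a ^ p + b ^ p) := by
  have h1 : (a + b) ^ p ≤ (2 * max a b) ^ p := by
    refine Real.rpow_le_rpow (by positivity) ?_ hp
    linarith [le_max_left a b, le_max_right a b]
  refine h1.trans ?_
  rw [Real.mul_rpow (by norm_num) (le_max_of_le_left ha)]
  have h2 : (max a b) ^ p ≤ a ^ p + b ^ p := by
    have := Real.rpow_nonneg ha p
    have := Real.rpow_nonneg hb p
    rcases max_choice a b with h | h <;> rw [h] <;> linarith
  gcongr

/-- Substitute for the triangle inequality in weights |x|^{1/t}. The exponent may lie on either side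
of 1, so neither subadditivity nor convexity of the power covers all cases; comparison with twice
the maximum does, at the cost of 2^p. -/
lemma norm_rpow_le_two_rpow_mul {V : Type*} [NormedAddCommGroup V] {p : ℝ} (hp : 0 ≤ p) (x y : V) :
    ‖x‖ ^ p ≤ 2 ^ p * (‖y‖ ^ p + ‖y - x‖ ^ p) := by
  refine le_trans ?_ (add_rpow_le_two_rpow_mul (norm_nonneg _) (norm_nonneg _) hp)
  refine Real.rpow_le_rpow (norm_nonneg _) ?_ hp
  calc ‖x‖ = ‖y - (y - x)‖ := by rw [sub_sub_cancel]
    _ ≤ _ := norm_sub_le _ _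

/-- This is y^m / m! ≤ e^y for y = (a/h)^{1/s}, raised to the power s. The constant is explicit
because its growth in a becomes the exponential growth of the norms of time-frequency shifts. -/
lemma pow_le_exp_mul_factorial_rpow {h a : ℝ} (hh : 0 < h) (hs : 0 < s) (ha : 0 ≤ a) (m : ℕ) :
    a ^ m ≤ Real.exp (s * (a / h) ^ (1 / s)) * (h ^ m * (m.factorial : ℝ) ^ s) := by
  have hf : (0 : ℝ) < m.factorial := by exact_mod_cast m.factorial_pos
  have h0 : 0 ≤ a / h := by positivity
  have h1 := Real.pow_div_factorial_le_exp (x := (a / h) ^ (1 / s)) (by positivity) m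
  rw [div_le_iff₀ hf] at h1
  have h2 := Real.rpow_le_rpow (by positivity) h1 hs.le
  rw [Real.mul_rpow (by positivity) hf.le] at h2
  have h3 : (((a / h) ^ (1 / s)) ^ m) ^ s = (a / h) ^ m := by
    rw [← Real.rpow_natCast, ← Real.rpow_mul h0, ← Real.rpow_mul h0, ← Real.rpow_natCast]
    congr 1
    field_simp
  rw [h3, div_pow, div_le_iff₀ (by positivity), ← Real.exp_mul, mul_comm _ s] at h2
  linarith

/-- Converse to the previous estimate: factorial bounds of all orders amount to exponential decay.
With Y = (X/c)^{1/τ}, the τ-th root of the hypothesis reads Y^n B^{1/τ} / n! ≤ A^{1/τ}. Multiplying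
by 2^{-n} and summing over n gives e^{Y/2} B^{1/τ} ≤ 2 A^{1/τ}. The weights 2^{-n} account for the
halved exponent and the factor 2^τ. -/
lemma le_exp_neg_of_forall_pow_mul_le {c τ X A B : ℝ} (hc : 0 < c) (hτ : 0 < τ) (hX : 0 ≤ X)
    (hB : 0 ≤ B) (h : ∀ n : ℕ, X ^ n * B ≤ A * (c ^ n * (n.factorial : ℝ) ^ τ)) :
    B ≤ 2 ^ τ * A * Real.exp (-(τ / 2 * (X / c) ^ (1 / τ))) := by
  have hA : 0 ≤ A := by
    have := h 0
    simp only [pow_zero, one_mul, Nat.factorial_zero, Nat.cast_one, Real.one_rpow, mul_one] at this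
    exact hB.trans this
  have hXc : 0 ≤ X / c := by positivity
  set Y := (X / c) ^ (1 / τ) with hY
  have hY0 : 0 ≤ Y := by positivity
  have hYn : ∀ n : ℕ, (Y ^ n) ^ τ = (X / c) ^ n := by
    intro n
    rw [hY, ← Real.rpow_natCast, ← Real.rpow_mul hXc, ← Real.rpow_mul hXc, ← Real.rpow_natCast]
    congr 1
    field_simp
  set B' := B ^ (1 / τ) with hB'
  set A' := A ^ (1 / τ) with hA'
  have hBB : B' ^ τ = B := by
    rw [hB', ← Real.rpow_mul hB, one_div_mul_cancel hτ.ne', Real.rpow_one]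
  have hAA : A' ^ τ = A := by
    rw [hA', ← Real.rpow_mul hA, one_div_mul_cancel hτ.ne', Real.rpow_one]
  have hA'0 : 0 ≤ A' := by positivity
  have hB'0 : 0 ≤ B' := by positivity
  have h1 : ∀ n : ℕ, (Y / 2) ^ n / (n.factorial : ℝ) * B' ≤ (1 / 2) ^ n * A' := by
    intro n
    have hf : (0 : ℝ) < n.factorial := by exact_mod_cast n.factorial_pos
    have h2 : Y ^ n * B' ≤ A' * n.factorial := by
      refine (Real.rpow_le_rpow_iff (by positivity) (by positivity) hτ).1 ?_
      rw [Real.mul_rpow (by positivity) hB'0, Real.mul_rpow hA'0 hf.le, hYn, hBB, hAA, div_pow,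
        div_mul_eq_mul_div, div_le_iff₀ (by positivity)]
      refine (h n).trans (le_of_eq ?_)
      ring
    rw [div_pow, div_pow, one_pow, div_div, div_mul_eq_mul_div, div_le_iff₀ (by positivity)]
    refine h2.trans (le_of_eq ?_)
    field_simp
  have hs1 : HasSum (fun n : ℕ => (Y / 2) ^ n / (n.factorial : ℝ) * B') (Real.exp (Y / 2) * B') := by
    rw [Real.exp_eq_exp_ℝ]
    exact (NormedSpace.expSeries_div_hasSum_exp (Y / 2)).mul_right B'
  have h3 : Real.exp (Y / 2) * B' ≤ 2 * A' :=
    hasSum_le h1 hs1 (hasSum_geometric_two.mul_right A')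
  have h4 := Real.rpow_le_rpow (by positivity) h3 hτ.le
  rw [Real.mul_rpow (by positivity) hB'0, Real.mul_rpow (by norm_num) hA'0, hBB, hAA,
    ← Real.exp_mul] at h4
  rw [Real.exp_neg, ← div_eq_mul_inv, le_div_iff₀ (Real.exp_pos _), mul_comm]
  have e : τ / 2 * Y = Y / 2 * τ := by ring
  rwa [e]

lemma integrable_exp_neg_mul_norm_rpow {a p : ℝ} (ha : 0 < a) (hp : 0 < p) :
    Integrable (fun x : Rd d => Real.exp (-(a * ‖x‖ ^ p))) := by
  set n : ℕ := d + 1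
  have hn : (Module.finrank ℝ (Rd d) : ℝ) < n := by simp [n]
  have hint := integrable_one_add_norm (E := Rd d) (μ := volume) hn
  have hσ : 0 < 1 / p := by positivity
  -- `(1 + ‖x‖)^n ≤ C exp (a ‖x‖^p)`
  obtain ⟨C, hC⟩ : ∃ C : ℝ, ∀ y : ℝ, 0 ≤ y → (1 + y) ^ n ≤ C * Real.exp (a * y ^ p) := by
    set q : ℝ := 1 / p
    -- Chosen so that q (y/h)^{1/q} = a y^p.
    set h : ℝ := (q / a) ^ (1 / p) with hh
    have hhp : 0 < h := by positivity
    have key : ∀ y : ℝ, 0 ≤ y → y ^ n ≤ (h ^ n * (n.factorial : ℝ) ^ q) * Real.exp (a * y ^ p) := by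
      intro y hy
      have := pow_le_exp_mul_factorial_rpow (s := q) hhp hσ hy n
      have e : q * (y / h) ^ (1 / q) = a * y ^ p := by
        have : 1 / q = p := by simp [q]
        rw [this, Real.div_rpow hy hhp.le, hh, ← Real.rpow_mul (by positivity),
          one_div_mul_cancel hp.ne', Real.rpow_one]
        field_simp
      rw [e] at this
      linarith
    refine ⟨2 ^ n * (1 + h ^ n * (n.factorial : ℝ) ^ q), fun y hy => ?_⟩
    have h1 : (1 : ℝ) ≤ Real.exp (a * y ^ p) := Real.one_le_exp (by positivity)
    have h2 := key y hy
    have h3 : (1 + y) ^ n ≤ 2 ^ n * (1 + y ^ n) := by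
      have := add_pow_le (zero_le_one) hy n
      refine this.trans ?_
      rw [one_pow]
      gcongr
      · norm_num
      · omega
    refine h3.trans ?_
    rw [mul_assoc]
    gcongr
    rw [add_mul]
    linarith
  refine (hint.const_mul C).mono' ?_ (Filter.Eventually.of_forall fun x => ?_)
  · exact (Real.continuous_exp.comp ((continuous_const.mul
      (continuous_norm.rpow_const (fun _ => Or.inr hp.le))).neg)).aestronglyMeasurable
  · have h1 := hC ‖x‖ (norm_nonneg x)
    rw [Real.norm_eq_abs, abs_of_pos (Real.exp_pos _), Real.exp_neg, Real.rpow_neg (by positivity),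
      Real.rpow_natCast, ← div_eq_mul_inv, le_div_iff₀ (by positivity), ← div_eq_inv_mul,
      div_le_iff₀ (Real.exp_pos _)]
    exact h1

/-- The function `|x|^{1/t} + |ξ|^{1/s}` on phase space. -/
def phaseWeight (t s : ℝ) (z : Rd d × Rd d) : ℝ := ‖z.1‖ ^ (1 / t) + ‖z.2‖ ^ (1 / s)

lemma continuous_phaseWeight (ht : 0 < t) (hs : 0 < s) :
    Continuous (phaseWeight t s : Rd d × Rd d → ℝ) := by
  have h1 : 0 ≤ 1 / t := by positivity
  have h2 : 0 ≤ 1 / s := by positivity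
  exact (continuous_fst.norm.rpow_const fun _ => Or.inr h1).add
    (continuous_snd.norm.rpow_const fun _ => Or.inr h2)

lemma integrable_exp_neg_mul_phaseWeight (ht : 0 < t) (hs : 0 < s) {a : ℝ} (ha : 0 < a) :
    Integrable (fun z : Rd d × Rd d => Real.exp (-(a * phaseWeight t s z))) := by
  have h1 := integrable_exp_neg_mul_norm_rpow (d := d) ha (one_div_pos.2 ht)
  have h2 := integrable_exp_neg_mul_norm_rpow (d := d) ha (one_div_pos.2 hs)
  have := h1.mul_prod h2
  rw [← Measure.volume_eq_prod] at this
  refine this.congr (Filter.Eventually.of_forall fun z => ?_)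
  simp only [phaseWeight]
  rw [← Real.exp_add]
  congr 1
  ring

/-- Applies the scalar lemma through the largest coordinate, which controls ‖ξ‖ up to the factor d +
1; this factor stays positive when d = 0. In that case there are no coordinates, and the order n = 0
is supplied by B ≤ A. -/
lemma le_exp_neg_of_forall_coord {c τ A B : ℝ} (hc : 0 < c) (hτ : 0 < τ) (ξ : Rd d)
    (hB : 0 ≤ B) (hBA : B ≤ A)
    (h : ∀ (j : Fin d) (n : ℕ), |ξ j| ^ n * B ≤ A * (c ^ n * (n.factorial : ℝ) ^ τ)) :
    B ≤ 2 ^ τ * A * Real.exp (-(τ / 2 * (‖ξ‖ / ((d + 1) * c)) ^ (1 / τ))) := by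
  refine le_exp_neg_of_forall_pow_mul_le (by positivity) hτ (norm_nonneg ξ) hB fun n => ?_
  have hA : 0 ≤ A := hB.trans hBA
  rcases isEmpty_or_nonempty (Fin d) with hd | hd
  · have hξ : ‖ξ‖ = 0 := by
      rw [norm_eq_zero]; ext i; exact isEmptyElim i
    rw [hξ]
    rcases Nat.eq_zero_or_pos n with hn | hn
    · subst hn; simpa using hBA
    · rw [zero_pow hn.ne', zero_mul]; positivity
  · obtain ⟨j, hj⟩ := Finite.exists_max (fun i => |ξ i|)
    have h1 : ‖ξ‖ ≤ (d + 1) * |ξ j| := by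
      have h2 : ‖ξ‖ ≤ ∑ i, |ξ i| := by
        have e : (∑ i, EuclideanSpace.single i (ξ i) : Rd d) = ξ := by
          ext i
          simp [Finset.sum_apply, Pi.single_apply]
        calc ‖ξ‖ = ‖∑ i, EuclideanSpace.single i (ξ i)‖ := by rw [e]
          _ ≤ ∑ i, ‖EuclideanSpace.single i (ξ i)‖ := norm_sum_le _ _
          _ = ∑ i, |ξ i| := by simp
      refine h2.trans ((Finset.sum_le_card_nsmul _ _ _ fun i _ => hj i).trans ?_)
      simp only [Finset.card_univ, Fintype.card_fin, nsmul_eq_mul]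
      have := abs_nonneg (ξ j)
      nlinarith
    calc ‖ξ‖ ^ n * B ≤ ((d + 1) * |ξ j|) ^ n * B := by gcongr
      _ = (d + 1) ^ n * (|ξ j| ^ n * B) := by rw [mul_pow]; ring
      _ ≤ (d + 1) ^ n * (A * (c ^ n * (n.factorial : ℝ) ^ τ)) :=
        mul_le_mul_of_nonneg_left (h j n) (by positivity)
      _ = _ := by rw [mul_pow]; ring

/-- Where the Beurling condition enters: since every h > 0 is allowed in the norms, every
exponential rate a can be reached. -/
lemma exists_rpow_div_eq {τ a c : ℝ} (hτ : 0 < τ) (ha : 0 < a) (hc : 0 < c) :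
    ∃ h : ℝ, 0 < h ∧ ∀ X : ℝ, 0 ≤ X → τ / 2 * (X / (c * h)) ^ (1 / τ) = a * X ^ (1 / τ) := by
  refine ⟨(τ / 2 / a) ^ τ / c, by positivity, fun X hX => ?_⟩
  rw [mul_div_cancel₀ _ hc.ne', Real.div_rpow hX (by positivity), ← Real.rpow_mul (by positivity),
    mul_one_div_cancel hτ.ne', Real.rpow_one]
  field_simp

/-! ### Gelfand–Shilov estimates with explicit constants -/

/-- The function `f` is smooth and `|x^α ∂^β f(x)| ≤ A h^{|α|} k^{|β|} α!^t β!^s`. -/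
def GSBound (t s A h k : ℝ) (f : Rd d → ℂ) : Prop :=
  ContDiff ℝ ∞ f ∧ ∀ α β x, |monom α x| * ‖pderiv β f x‖ ≤
    A * (h ^ mlen α * k ^ mlen β * (mfact α : ℝ) ^ t * (mfact β : ℝ) ^ s)

lemma GelfandShilov.contDiff (φ : GelfandShilov d t s) : ContDiff ℝ ∞ (φ : Rd d → ℂ) := φ.2.1

lemma GelfandShilov.exists_gsBound (φ : GelfandShilov d t s) {h k : ℝ} (hh : 0 < h) (hk : 0 < k) :
    ∃ A : ℝ, 0 ≤ A ∧ GSBound t s A h k φ := by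
  obtain ⟨h1, h2⟩ := isGS_iff.1 φ.2
  obtain ⟨A, hA, hb⟩ := h2 (min h k) (lt_min hh hk)
  refine ⟨A, hA, h1, fun α β x => (hb α β x).trans ?_⟩
  have hm : 0 ≤ min h k := (lt_min hh hk).le
  rw [pow_add]
  gcongr
  · exact min_le_left _ _
  · exact min_le_right _ _

lemma mlen_zero : mlen (0 : Fin d → ℕ) = 0 := by simp [mlen]

lemma mfact_zero : mfact (0 : Fin d → ℕ) = 1 := by simp [mfact]

lemma monom_zero (x : Rd d) : monom 0 x = 1 := by simp [monom]

lemma pdList_zero (l : List (Fin d)) (f : Rd d → ℂ) : pdList l 0 f = f := by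
  induction l with
  | nil => rfl
  | cons i l ih => simp only [pdList, List.foldr_cons] at ih ⊢; rw [ih]; rfl

lemma pderiv_zero (f : Rd d → ℂ) : pderiv 0 f = f := pdList_zero _ f

lemma GSBound.norm_pderiv_le (ht : 0 < t) {A h k : ℝ} (hh : 0 < h) {f : Rd d → ℂ}
    (hf : GSBound t s A h k f) (β : Fin d → ℕ) (y : Rd d) :
    ‖pderiv β f y‖ ≤ 2 ^ t * (A * (k ^ mlen β * (mfact β : ℝ) ^ s)) *
      Real.exp (-(t / 2 * (‖y‖ / ((d + 1) * h)) ^ (1 / t))) := by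
  refine le_exp_neg_of_forall_coord hh ht y (norm_nonneg _) ?_ fun j n => ?_
  · simpa [mlen_zero, mfact_zero, monom_zero] using hf.2 0 β y
  · have e : Function.update (0 : Fin d → ℕ) j 0 = 0 := by
      ext i; by_cases hi : i = j
      · subst hi; simp
      · simp [hi]
    have := hf.2 (Function.update 0 j n) β y
    rw [monom_split, mlen_update, mfact_update, e, mlen_zero, mfact_zero, monom_zero, mul_one,
      mul_one, add_zero, abs_pow] at this
    refine this.trans (le_of_eq ?_)
    ring

/-- The parameter h for the monomials depends on the rate a alone, so spatial decay is bought
without changing the parameter k that governs the derivatives. -/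
lemma exists_norm_pderiv_le_of_gsBound (d : ℕ) (s : ℝ) (ht : 0 < t) {a : ℝ} (ha : 0 < a) :
    ∃ h : ℝ, 0 < h ∧ ∀ (A k : ℝ) (f : Rd d → ℂ), GSBound t s A h k f → ∀ β y,
      ‖pderiv β f y‖ ≤ 2 ^ t * (A * (k ^ mlen β * (mfact β : ℝ) ^ s)) *
        Real.exp (-(a * ‖y‖ ^ (1 / t))) := by
  obtain ⟨h, hh, he⟩ := exists_rpow_div_eq (c := (d : ℝ) + 1) ht ha (by positivity)
  refine ⟨h, hh, fun A k f hf β y => ?_⟩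
  have := hf.norm_pderiv_le ht hh β y
  rwa [he _ (norm_nonneg _)] at this

/-- Leibniz' rule in the variable x_j: derivatives of the character produce powers of c, absorbed by
`pow_le_exp_mul_factorial_rpow`, and the binomial coefficients sum to 2^n, which doubles k. The
spatial parameter h is untouched. -/
lemma GSBound.modCoord (hs : 0 < s) {A h k : ℝ} (hA : 0 ≤ A) (hh : 0 < h) (hk : 0 < k)
    (j : Fin d) (c : ℝ) {f : Rd d → ℂ} (hf : GSBound t s A h k f) :
    GSBound t s (Real.exp (s * (|c| / k) ^ (1 / s)) * A) h (2 * k) (modCoord j c f) := by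
  obtain ⟨hf, hA'⟩ := hf
  refine ⟨contDiff_modCoord j c hf, fun α β x => ?_⟩
  have hB := pow_le_exp_mul_factorial_rpow (s := s) hk hs (abs_nonneg c)
  set B := Real.exp (s * (|c| / k) ^ (1 / s))
  have hB0 : 0 ≤ B := (Real.exp_pos _).le
  set β₀ := Function.update β j 0 with hβ₀
  have hβ : ∀ k, pderiv (Function.update β j k) f x = (pd j)^[k] (pderiv β₀ f) x := by
    intro k
    rw [pderiv_split j _ hf]
    simp [hβ₀]
  have hm : mlen β = β j + mlen β₀ := by
    have := mlen_update j (β j) β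
    rwa [Function.update_eq_self] at this
  have hfm : mfact β = (β j).factorial * mfact β₀ := by
    have := mfact_update j (β j) β
    rwa [Function.update_eq_self] at this
  have h1 : ‖pderiv β (GS.modCoord j c f) x‖ ≤
      ∑ ij ∈ Finset.HasAntidiagonal.antidiagonal (β j), (β j).choose ij.1 •
        (|c| ^ ij.1 * ‖(pd j)^[ij.2] (pderiv β₀ f) x‖) := by
    rw [pderiv_split j β (contDiff_modCoord j c hf), pderiv, pdList_modCoord j c hf _ (by simp)]
    exact norm_pd_iterate_modCoord_le j c x (β j) _ (contDiff_pderiv hf β₀)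
  have h2 := sum_choose_le (q := k) (a := |c|) (B := B)
    (A := A * (h ^ mlen α * k ^ mlen β₀ * (mfact α : ℝ) ^ t * (mfact β₀ : ℝ) ^ s))
    hk.le (by positivity) hB0 (abs_nonneg c) hs
    (fun k => |monom α x| * ‖(pd j)^[k] (pderiv β₀ f) x‖)
    (by
      intro k
      have := hA' α (Function.update β j k) x
      rw [hβ, mlen_update, mfact_update] at this
      refine this.trans (le_of_eq ?_)
      push_cast
      rw [Real.mul_rpow (by positivity) (by positivity)]
      ring) hB (β j)
  calc |monom α x| * ‖pderiv β (GS.modCoord j c f) x‖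
      ≤ |monom α x| * ∑ ij ∈ Finset.HasAntidiagonal.antidiagonal (β j), (β j).choose ij.1 •
          (|c| ^ ij.1 * ‖(pd j)^[ij.2] (pderiv β₀ f) x‖) := by gcongr
    _ = ∑ ij ∈ Finset.HasAntidiagonal.antidiagonal (β j), (β j).choose ij.1 •
          (|c| ^ ij.1 * (|monom α x| * ‖(pd j)^[ij.2] (pderiv β₀ f) x‖)) := by
        rw [Finset.mul_sum]
        refine Finset.sum_congr rfl fun _ _ => ?_
        simp only [nsmul_eq_mul]
        ring
    _ ≤ _ := h2
    -- Only the order in x_j has acquired a factor 2; the other orders are enlarged to 2k as well,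
    -- so that one parameter serves all of β.
    _ ≤ B * (A * (h ^ mlen α * (2 * k) ^ mlen β₀ * (mfact α : ℝ) ^ t * (mfact β₀ : ℝ) ^ s)) *
          ((2 * k) ^ (β j) * ((β j).factorial : ℝ) ^ s) := by
        gcongr
        linarith
    _ = _ := by
        rw [hm, hfm]
        push_cast
        rw [Real.mul_rpow (by positivity) (by positivity)]
        ring

/-- One coordinate at a time: each of the d steps doubles k and adds at most s(‖ξ‖/k)^{1/s} to the
exponent, since the later steps divide by larger parameters. -/
lemma GSBound.modulate (hs : 0 < s) {A h k : ℝ} (hA : 0 ≤ A) (hh : 0 < h) (hk : 0 < k)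
    (ξ : Rd d) {f : Rd d → ℂ} (hf : GSBound t s A h k f) :
    GSBound t s (Real.exp (s * d * (‖ξ‖ / k) ^ (1 / s)) * A) h (2 ^ d * k) (modulate ξ f) := by
  have key : ∀ S : Finset (Fin d), GSBound t s
      (Real.exp (s * S.card * (‖ξ‖ / k) ^ (1 / s)) * A) h (2 ^ S.card * k)
      (fun y => Complex.exp (Complex.I * ((∑ j ∈ S, ξ j * y j : ℝ) : ℂ)) * f y) := by
    intro S
    induction S using Finset.induction_on with
    | empty => simpa using hf
    | insert j S hj ih =>
      have h1 := ih.modCoord hs (by positivity) hh (by positivity) j (ξ j)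
      rw [Finset.card_insert_of_notMem hj]
      have e : (fun y => Complex.exp (Complex.I * ((∑ i ∈ insert j S, ξ i * y i : ℝ) : ℂ)) * f y) =
          GS.modCoord j (ξ j)
            (fun y => Complex.exp (Complex.I * ((∑ i ∈ S, ξ i * y i : ℝ) : ℂ)) * f y) := by
        funext y
        rw [Finset.sum_insert hj]
        simp only [GS.modCoord]
        rw [← mul_assoc, ← Complex.exp_add]
        push_cast
        ring_nf
      rw [e]
      refine ⟨h1.1, fun α β x => (h1.2 α β x).trans ?_⟩
      have e2 : 2 * (2 ^ S.card * k) = 2 ^ (S.card + 1) * k := by ring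
      rw [e2, ← mul_assoc (Real.exp _) (Real.exp _) A, ← Real.exp_add]
      have h3 : (|ξ j| / (2 ^ S.card * k)) ^ (1 / s) ≤ (‖ξ‖ / k) ^ (1 / s) := by
        refine Real.rpow_le_rpow (by positivity) ?_ (by positivity)
        have h4 : |ξ j| ≤ ‖ξ‖ := by simpa using PiLp.norm_apply_le ξ j
        have h5 : k ≤ 2 ^ S.card * k := by
          have : (1 : ℝ) ≤ 2 ^ S.card := one_le_pow₀ (by norm_num)
          nlinarith
        gcongr
      gcongr
      push_cast
      nlinarith
  have := key Finset.univ
  simp only [Finset.card_univ, Fintype.card_fin] at this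
  convert this using 1
  funext y
  simp [GS.modulate, PiLp.inner_apply, mul_comm]

/-- Dual to the modulation estimate: the binomial expansion of (a + y_j)^n takes the place of
Leibniz' rule, and h is doubled while k is kept. -/
lemma GSBound.translate_single (ht : 0 < t) {A h k : ℝ} (hA : 0 ≤ A) (hh : 0 < h) (hk : 0 < k)
    (j : Fin d) (a : ℝ) {f : Rd d → ℂ} (hf : GSBound t s A h k f) :
    GSBound t s (Real.exp (t * (|a| / h) ^ (1 / t)) * A) (2 * h) k
      (translate (EuclideanSpace.single j a) f) := by
  obtain ⟨hf, hA'⟩ := hf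
  refine ⟨hf.comp (contDiff_id.sub contDiff_const), fun α β x => ?_⟩
  have hB := pow_le_exp_mul_factorial_rpow (s := t) hh ht (abs_nonneg a)
  set B := Real.exp (t * (|a| / h) ^ (1 / t))
  have hB0 : 0 ≤ B := (Real.exp_pos _).le
  set α₀ := Function.update α j 0 with hα₀
  set y := x - EuclideanSpace.single j a with hy
  have hm : mlen α = α j + mlen α₀ := by
    have := mlen_update j (α j) α
    rwa [Function.update_eq_self] at this
  have hfm : mfact α = (α j).factorial * mfact α₀ := by
    have := mfact_update j (α j) α
    rwa [Function.update_eq_self] at this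
  have hmon : monom α x = x j ^ (α j) * monom α₀ x := by
    have := monom_split j (α j) α x
    rwa [Function.update_eq_self] at this
  have hxy : x j = a + y j := by simp [hy]
  have hmon₀ : monom α₀ x = monom α₀ y := by
    unfold monom
    refine Finset.prod_congr rfl fun i _ => ?_
    by_cases hij : i = j
    · subst hij; simp [hα₀]
    · simp [hy, hij]
  have hder : pderiv β (GS.translate (EuclideanSpace.single j a) f) x = pderiv β f y := by
    rw [pderiv, pdList_translate]; rfl
  have h2 := sum_choose_le (q := h) (a := |a|) (B := B)
    (A := A * (h ^ mlen α₀ * k ^ mlen β * (mfact α₀ : ℝ) ^ t * (mfact β : ℝ) ^ s))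
    hh.le (by positivity) hB0 (abs_nonneg a) ht
    (fun k => |y j| ^ k * (|monom α₀ y| * ‖pderiv β f y‖))
    (by
      intro k
      have := hA' (Function.update α j k) β y
      rw [monom_split, mlen_update, mfact_update, abs_mul, abs_pow] at this
      rw [← mul_assoc]
      refine this.trans (le_of_eq ?_)
      push_cast
      rw [Real.mul_rpow (by positivity) (by positivity)]
      ring) hB (α j)
  calc |monom α x| * ‖pderiv β (GS.translate (EuclideanSpace.single j a) f) x‖
      = |a + y j| ^ (α j) * (|monom α₀ y| * ‖pderiv β f y‖) := by
        rw [hder, hmon, hmon₀, hxy, abs_mul, abs_pow]; ring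
    _ ≤ (|a| + |y j|) ^ (α j) * (|monom α₀ y| * ‖pderiv β f y‖) := by
        gcongr
        exact abs_add_le _ _
    _ = ∑ ij ∈ Finset.HasAntidiagonal.antidiagonal (α j), (α j).choose ij.1 •
          (|a| ^ ij.1 * (|y j| ^ ij.2 * (|monom α₀ y| * ‖pderiv β f y‖))) := by
        rw [(Commute.all (|a|) (|y j|)).add_pow', Finset.sum_mul]
        refine Finset.sum_congr rfl fun _ _ => ?_
        simp only [nsmul_eq_mul]
        ring
    _ ≤ _ := h2
    _ ≤ B * (A * ((2 * h) ^ mlen α₀ * k ^ mlen β * (mfact α₀ : ℝ) ^ t * (mfact β : ℝ) ^ s)) *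
          ((2 * h) ^ (α j) * ((α j).factorial : ℝ) ^ t) := by
        gcongr
        linarith
    _ = _ := by
        rw [hm, hfm]
        push_cast
        rw [Real.mul_rpow (by positivity) (by positivity)]
        ring

lemma GSBound.translate (ht : 0 < t) {A h k : ℝ} (hA : 0 ≤ A) (hh : 0 < h) (hk : 0 < k)
    (x : Rd d) {f : Rd d → ℂ} (hf : GSBound t s A h k f) :
    GSBound t s (Real.exp (t * d * (‖x‖ / h) ^ (1 / t)) * A) (2 ^ d * h) k (translate x f) := by
  have key : ∀ S : Finset (Fin d), GSBound t s
      (Real.exp (t * S.card * (‖x‖ / h) ^ (1 / t)) * A) (2 ^ S.card * h) k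
      (GS.translate (∑ j ∈ S, EuclideanSpace.single j (x j)) f) := by
    intro S
    induction S using Finset.induction_on with
    | empty =>
      have h0 : GS.translate (0 : Rd d) f = f := by funext y; simp [GS.translate]
      rw [Finset.sum_empty, h0]
      simpa using hf
    | insert j S hj ih =>
      have h1 := ih.translate_single ht (by positivity) (by positivity) hk j (x j)
      rw [Finset.card_insert_of_notMem hj]
      have e : GS.translate (∑ j ∈ insert j S, EuclideanSpace.single j (x j)) f =
          GS.translate (EuclideanSpace.single j (x j))
            (GS.translate (∑ j ∈ S, EuclideanSpace.single j (x j)) f) := by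
        funext y
        simp [GS.translate, Finset.sum_insert hj, sub_sub]
      rw [e]
      refine ⟨h1.1, fun α β y => (h1.2 α β y).trans ?_⟩
      have e2 : 2 * (2 ^ S.card * h) = 2 ^ (S.card + 1) * h := by ring
      rw [e2, ← mul_assoc (Real.exp _) (Real.exp _) A, ← Real.exp_add]
      have h3 : (|x j| / (2 ^ S.card * h)) ^ (1 / t) ≤ (‖x‖ / h) ^ (1 / t) := by
        refine Real.rpow_le_rpow (by positivity) ?_ (by positivity)
        have h4 : |x j| ≤ ‖x‖ := by simpa using PiLp.norm_apply_le x j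
        have h5 : h ≤ 2 ^ S.card * h := by
          have : (1 : ℝ) ≤ 2 ^ S.card := one_le_pow₀ (by norm_num)
          nlinarith
        gcongr
      gcongr
      push_cast
      nlinarith
  have := key Finset.univ
  have hx : (∑ j, EuclideanSpace.single j (x j) : Rd d) = x := by
    ext i
    simp [Finset.sum_apply, Pi.single_apply]
  rwa [hx, Finset.card_univ, Fintype.card_fin] at this

/-! ### Time-frequency shifts -/

/-- The function `M_ξ T_x f` for `z = (x, ξ)`. -/
def tfFun (f : Rd d → ℂ) (z : Rd d × Rd d) : Rd d → ℂ := modulate z.2 (translate z.1 f)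

lemma tfFun_apply (f : Rd d → ℂ) (z : Rd d × Rd d) (y : Rd d) :
    tfFun f z y = Complex.exp (Complex.I * ((inner ℝ y z.2 : ℝ) : ℂ)) * f (y - z.1) := rfl

lemma norm_exp_I_mul_ofReal (r : ℝ) : ‖Complex.exp (Complex.I * (r : ℂ))‖ = 1 := by
  rw [mul_comm, Complex.norm_exp_ofReal_mul_I]

lemma norm_tfFun (f : Rd d → ℂ) (z : Rd d × Rd d) (y : Rd d) : ‖tfFun f z y‖ = ‖f (y - z.1)‖ := by
  rw [tfFun_apply, norm_mul, norm_exp_I_mul_ofReal, one_mul]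

/-- The commutation relation of translation and modulation. Its use is that, up to a factor of
modulus one, derivatives of M_ξ T_x f are translates of those of M_ξ f, so their decay is centred at
x and no growth in x is incurred. -/
lemma tfFun_eq_smul_translate (f : Rd d → ℂ) (z : Rd d × Rd d) :
    tfFun f z = Complex.exp (Complex.I * ((inner ℝ z.1 z.2 : ℝ) : ℂ)) •
      translate z.1 (modulate z.2 f) := by
  funext y
  simp only [tfFun_apply, Pi.smul_apply, translate, modulate, smul_eq_mul]
  rw [← mul_assoc, ← Complex.exp_add, ← mul_add, ← Complex.ofReal_add, ← inner_add_left,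
    add_sub_cancel]

lemma contDiff_tfFun {f : Rd d → ℂ} (hf : ContDiff ℝ ∞ f) :
    ContDiff ℝ ∞ (fun p : (Rd d × Rd d) × Rd d => tfFun f p.1 p.2) := by
  simp only [tfFun_apply]
  refine ContDiff.mul ?_ (hf.comp (contDiff_snd.sub contDiff_fst.fst))
  refine ContDiff.cexp (contDiff_const.mul (Complex.ofRealCLM.contDiff.comp ?_))
  exact contDiff_snd.inner ℝ contDiff_fst.snd

lemma contDiff_modulate (ξ : Rd d) {f : Rd d → ℂ} (hf : ContDiff ℝ ∞ f) :
    ContDiff ℝ ∞ (modulate ξ f) := by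
  refine ContDiff.mul ?_ hf
  refine ContDiff.cexp (contDiff_const.mul (Complex.ofRealCLM.contDiff.comp ?_))
  exact contDiff_id.inner ℝ contDiff_const

lemma contDiff_translate (x : Rd d) {f : Rd d → ℂ} (hf : ContDiff ℝ ∞ f) :
    ContDiff ℝ ∞ (translate x f) := hf.comp (contDiff_id.sub contDiff_const)

lemma norm_pderiv_tfFun {f : Rd d → ℂ} (hf : ContDiff ℝ ∞ f) (z : Rd d × Rd d) (β : Fin d → ℕ)
    (y : Rd d) : ‖pderiv β (tfFun f z) y‖ = ‖pderiv β (modulate z.2 f) (y - z.1)‖ := by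
  rw [tfFun_eq_smul_translate, pderiv_smul _ (contDiff_translate _ (contDiff_modulate _ hf)),
    Pi.smul_apply, norm_smul, norm_exp_I_mul_ofReal, one_mul, pderiv, pdList_translate]
  rfl

/-- The frequency growth rate s d comes from taking k = 1 and does not depend on a. This
independence allows a to be chosen after the growth rate of the density in x is known. -/
lemma GelfandShilov.exists_norm_pderiv_tfFun_le (ht : 0 < t) (hs : 0 < s)
    (ψ : GelfandShilov d t s) {a : ℝ} (ha : 0 < a) :
    ∃ C : ℝ, 0 ≤ C ∧ ∀ z β y, ‖pderiv β (tfFun ψ z) y‖ ≤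
      C * ((2 ^ d) ^ mlen β * (mfact β : ℝ) ^ s) *
        (Real.exp (s * d * ‖z.2‖ ^ (1 / s)) * Real.exp (-(a * ‖y - z.1‖ ^ (1 / t)))) := by
  obtain ⟨h, hh, hle⟩ := exists_norm_pderiv_le_of_gsBound d s ht ha
  obtain ⟨A, hA, hψ⟩ := ψ.exists_gsBound hh one_pos
  refine ⟨2 ^ t * A, by positivity, fun z β y => ?_⟩
  rw [norm_pderiv_tfFun ψ.contDiff]
  refine (hle _ _ _ (hψ.modulate hs hA hh one_pos z.2) β _).trans (le_of_eq ?_)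
  rw [div_one, mul_one]
  ring

lemma GelfandShilov.exists_norm_le (ht : 0 < t) (φ : GelfandShilov d t s) {a : ℝ} (ha : 0 < a) :
    ∃ C : ℝ, 0 ≤ C ∧ ∀ y, ‖φ.1 y‖ ≤ C * Real.exp (-(a * ‖y‖ ^ (1 / t))) := by
  obtain ⟨h, hh, hle⟩ := exists_norm_pderiv_le_of_gsBound d s ht ha
  obtain ⟨A, hA, hφ⟩ := φ.exists_gsBound hh one_pos
  refine ⟨2 ^ t * A, by positivity, fun y => ?_⟩
  simpa [mlen_zero, mfact_zero, pderiv_zero] using hle _ _ _ hφ 0 y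

lemma GelfandShilov.exists_gsBound_tfFun (ht : 0 < t) (hs : 0 < s) (ψ : GelfandShilov d t s)
    {h k : ℝ} (hh : 0 < h) (hk : 0 < k) :
    ∃ C r : ℝ, 0 ≤ C ∧ 0 ≤ r ∧ ∀ z,
      GSBound t s (C * Real.exp (r * phaseWeight t s z)) h k (tfFun ψ z) := by
  -- Translation multiplies h by 2^d and modulation multiplies k by 2^d; starting from smaller
  -- parameters compensates exactly.
  set h' := h / 2 ^ d with hh'
  set k' := k / 2 ^ d with hk'
  have hh'0 : 0 < h' := by positivity
  have hk'0 : 0 < k' := by positivity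
  obtain ⟨A, hA, hψ⟩ := ψ.exists_gsBound hh'0 hk'0
  set r₁ := t * d * (1 / h') ^ (1 / t) with hr₁
  set r₂ := s * d * (1 / k') ^ (1 / s) with hr₂
  have h1 : 0 ≤ r₁ := by positivity
  have h2 : 0 ≤ r₂ := by positivity
  refine ⟨A, max r₁ r₂, hA, le_max_of_le_left h1, fun z => ?_⟩
  have h3 := (hψ.translate ht hA hh'0 hk'0 z.1).modulate hs (by positivity) (by positivity) hk'0 z.2
  have e1 : 2 ^ d * h' = h := by rw [hh']; field_simp
  have e2 : 2 ^ d * k' = k := by rw [hk']; field_simp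
  rw [e1, e2] at h3
  refine ⟨h3.1, fun α β y => (h3.2 α β y).trans ?_⟩
  have e3 : t * d * (‖z.1‖ / h') ^ (1 / t) = r₁ * ‖z.1‖ ^ (1 / t) := by
    rw [hr₁, div_eq_mul_one_div, Real.mul_rpow (by positivity) (by positivity)]; ring
  have e4 : s * d * (‖z.2‖ / k') ^ (1 / s) = r₂ * ‖z.2‖ ^ (1 / s) := by
    rw [hr₂, div_eq_mul_one_div, Real.mul_rpow (by positivity) (by positivity)]; ring
  rw [e3, e4, ← mul_assoc (Real.exp _) (Real.exp _) A, ← Real.exp_add, mul_comm A]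
  have h5 : r₂ * ‖z.2‖ ^ (1 / s) + r₁ * ‖z.1‖ ^ (1 / t) ≤ max r₁ r₂ * phaseWeight t s z := by
    unfold phaseWeight
    have h6 : 0 ≤ ‖z.1‖ ^ (1 / t) := by positivity
    have h7 : 0 ≤ ‖z.2‖ ^ (1 / s) := by positivity
    nlinarith [le_max_left r₁ r₂, le_max_right r₁ r₂]
  gcongr

/-! ### Leibniz estimates and integration by parts -/

lemma pd_mul (i : Fin d) {f g : Rd d → ℂ} (hf : ContDiff ℝ ∞ f) (hg : ContDiff ℝ ∞ g) :
    pd i (f * g) = f * pd i g + pd i f * g := by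
  funext x
  have h : fderiv ℝ (f * g) x = _ := ((hf.differentiable (by simp) x).hasFDerivAt.mul
    (hg.differentiable (by simp) x).hasFDerivAt).fderiv
  simp only [pd, h, Pi.add_apply, Pi.mul_apply]
  simp [mul_comm]

lemma norm_pd_iterate_mul_le (j : Fin d) (x : Rd d) (n : ℕ) :
    ∀ f g : Rd d → ℂ, ContDiff ℝ ∞ f → ContDiff ℝ ∞ g → ‖(pd j)^[n] (f * g) x‖ ≤
      ∑ ij ∈ Finset.HasAntidiagonal.antidiagonal n,
        n.choose ij.1 • (‖(pd j)^[ij.1] f x‖ * ‖(pd j)^[ij.2] g x‖) := by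
  induction n with
  | zero => intro f g _ _; simp
  | succ n ih =>
    intro f g hf hg
    rw [Finset.sum_antidiagonal_choose_succ_nsmul
      (fun i k => ‖(pd j)^[i] f x‖ * ‖(pd j)^[k] g x‖) n]
    rw [Function.iterate_succ_apply, pd_mul j hf hg,
      pd_iterate_add (f := f * pd j g) (g := pd j f * g) (hf.mul (contDiff_pd hg j))
        ((contDiff_pd hf j).mul hg)]
    refine (norm_add_le _ _).trans (add_le_add ?_ ?_)
    · exact ih f _ hf (contDiff_pd hg j)
    · refine (ih _ g (contDiff_pd hf j) hg).trans (le_of_eq (Finset.sum_congr rfl ?_))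
      rintro ⟨i, k⟩ hik
      rw [n.choose_symm_of_eq_add (Finset.HasAntidiagonal.mem_antidiagonal.1 hik).symm]
      rfl

/-- Uses i! j! ≤ (i + j)!, so each term has the size expected at order n, and the binomial
coefficients add up to 2^n. -/
lemma sum_choose_mul_le {A B q : ℝ} (hq : 0 ≤ q) (hA : 0 ≤ A) (hs : 0 < s) {b c : ℕ → ℝ}
    (hc0 : ∀ k, 0 ≤ c k)
    (hb : ∀ k, b k ≤ A * (q ^ k * (k.factorial : ℝ) ^ s))
    (hc : ∀ k, c k ≤ B * (q ^ k * (k.factorial : ℝ) ^ s)) (n : ℕ) :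
    ∑ ij ∈ Finset.HasAntidiagonal.antidiagonal n, n.choose ij.1 • (b ij.1 * c ij.2) ≤
      A * B * ((2 * q) ^ n * (n.factorial : ℝ) ^ s) := by
  have hB : 0 ≤ B := by simpa using (hc0 0).trans (hc 0)
  have key : ∀ ij ∈ Finset.HasAntidiagonal.antidiagonal n, n.choose ij.1 • (b ij.1 * c ij.2) ≤
      n.choose ij.1 • (A * B * (q ^ n * (n.factorial : ℝ) ^ s)) := by
    rintro ⟨i, j⟩ hij
    rw [Finset.HasAntidiagonal.mem_antidiagonal] at hij
    simp only at hij
    subst hij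
    refine nsmul_le_nsmul_right ?_ _
    have hfac : ((i.factorial : ℝ)) ^ s * (j.factorial : ℝ) ^ s ≤ ((i + j).factorial : ℝ) ^ s := by
      rw [← Real.mul_rpow (by positivity) (by positivity)]
      refine Real.rpow_le_rpow (by positivity) ?_ hs.le
      exact_mod_cast Nat.le_of_dvd (Nat.factorial_pos _)
        (Nat.factorial_mul_factorial_dvd_factorial_add i j)
    calc b i * c j ≤ (A * (q ^ i * (i.factorial : ℝ) ^ s)) * (B * (q ^ j * (j.factorial : ℝ) ^ s)) :=
          mul_le_mul (hb i) (hc j) (hc0 j) (by positivity)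
      _ = A * B * (q ^ (i + j) * ((i.factorial : ℝ) ^ s * (j.factorial : ℝ) ^ s)) := by ring
      _ ≤ _ := by gcongr
  refine (Finset.sum_le_sum key).trans (le_of_eq ?_)
  rw [← Finset.sum_smul, Finset.Nat.sum_antidiagonal_eq_sum_range_succ_mk]
  simp only [Nat.sum_range_choose, nsmul_eq_mul]
  push_cast
  ring

lemma pd_conj (i : Fin d) {f : Rd d → ℂ} (hf : ContDiff ℝ ∞ f) :
    pd i (fun x => starRingEnd ℂ (f x)) = fun x => starRingEnd ℂ (pd i f x) := by
  funext x
  have h : fderiv ℝ (fun x => starRingEnd ℂ (f x)) x = _ :=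
    ((Complex.conjCLE : ℂ →L[ℝ] ℂ).hasFDerivAt.comp x
      (hf.differentiable (by simp) x).hasFDerivAt).fderiv
  simp [pd, h]

lemma contDiff_conj {f : Rd d → ℂ} (hf : ContDiff ℝ ∞ f) :
    ContDiff ℝ ∞ (fun x => starRingEnd ℂ (f x)) :=
  (Complex.conjCLE : ℂ →L[ℝ] ℂ).contDiff.comp hf

lemma pd_iterate_conj (i : Fin d) {f : Rd d → ℂ} (hf : ContDiff ℝ ∞ f) (n : ℕ) :
    (pd i)^[n] (fun x => starRingEnd ℂ (f x)) = fun x => starRingEnd ℂ ((pd i)^[n] f x) := by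
  induction n with
  | zero => rfl
  | succ n ih =>
    rw [Function.iterate_succ_apply', ih, pd_conj i (contDiff_pd_iterate hf i n),
      Function.iterate_succ_apply']

lemma pd_iterate_translate (i : Fin d) (a : Rd d) (f : Rd d → ℂ) (n : ℕ) :
    (pd i)^[n] (translate a f) = translate a ((pd i)^[n] f) := by
  induction n with
  | zero => rfl
  | succ n ih => rw [Function.iterate_succ_apply', Function.iterate_succ_apply', ih, pd_translate]

lemma update_zero_zero (j : Fin d) : Function.update (0 : Fin d → ℕ) j 0 = 0 := by
  ext i; by_cases hi : i = j
  · subst hi; simp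
  · simp [hi]

lemma pderiv_update_zero (j : Fin d) (n : ℕ) {f : Rd d → ℂ} (hf : ContDiff ℝ ∞ f) :
    pderiv (Function.update 0 j n) f = (pd j)^[n] f := by
  rw [pderiv_split j _ hf, Function.update_self, Function.update_idem, update_zero_zero,
    pderiv_zero]

/-- The character `y ↦ e^{-i⟨y,ξ⟩}`. -/
def negChar (ξ : Rd d) (y : Rd d) : ℂ := Complex.exp (-(Complex.I * ((inner ℝ y ξ : ℝ) : ℂ)))

lemma norm_negChar (ξ y : Rd d) : ‖negChar ξ y‖ = 1 := by
  have := norm_exp_I_mul_ofReal (-(inner ℝ y ξ))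
  rwa [Complex.ofReal_neg, mul_neg] at this

lemma continuous_negChar (ξ : Rd d) : Continuous (negChar ξ) := by
  unfold negChar; fun_prop

lemma hasFDerivAt_negChar (ξ y : Rd d) :
    HasFDerivAt (negChar ξ) (negChar ξ y • -(Complex.I • (Complex.ofRealCLM.comp
      ((innerSL ℝ).flip ξ : Rd d →L[ℝ] ℝ)))) y := by
  have h1 : HasFDerivAt (fun y : Rd d => inner ℝ y ξ) ((innerSL ℝ).flip ξ : Rd d →L[ℝ] ℝ) y :=
    ((innerSL ℝ).flip ξ : Rd d →L[ℝ] ℝ).hasFDerivAt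
  have h2 := Complex.ofRealCLM.hasFDerivAt.comp y h1
  exact ((h2.const_mul Complex.I).neg).cexp

lemma fderiv_negChar_single (ξ y : Rd d) (j : Fin d) :
    fderiv ℝ (negChar ξ) y (EuclideanSpace.single j (1 : ℝ)) =
      -(Complex.I * (ξ j : ℂ)) * negChar ξ y := by
  rw [(hasFDerivAt_negChar ξ y).fderiv]
  have h : (innerSL ℝ) ξ (EuclideanSpace.single j (1 : ℝ)) = ξ j := by
    simp [EuclideanSpace.inner_single_right]
  simp [h]
  ring

lemma integrable_negChar_mul (ξ : Rd d) {g : Rd d → ℂ} (hg : Integrable g) :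
    Integrable (fun y => negChar ξ y * g y) :=
  hg.bdd_mul (c := 1) (continuous_negChar ξ).aestronglyMeasurable
    (Filter.Eventually.of_forall fun y => (norm_negChar ξ y).le)

lemma integral_negChar_mul_pd (ξ : Rd d) (j : Fin d) {g : Rd d → ℂ} (hg : ContDiff ℝ ∞ g)
    (h0 : Integrable g) (h1 : Integrable (pd j g)) :
    ∫ y, negChar ξ y * pd j g y = Complex.I * (ξ j : ℂ) * ∫ y, negChar ξ y * g y := by
  have hc := integrable_negChar_mul ξ h0
  have := integral_mul_fderiv_eq_neg_fderiv_mul_of_integrable (μ := volume) (f := negChar ξ)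
    (g := g) (v := EuclideanSpace.single j (1 : ℝ)) ?_ (integrable_negChar_mul ξ h1) hc
    (fun x _ => (hasFDerivAt_negChar ξ x).differentiableAt)
    (fun x _ => hg.differentiable (by simp) x)
  · simp only [pd]
    rw [this, ← integral_const_mul, ← integral_neg]
    refine integral_congr_ae (Filter.Eventually.of_forall fun y => ?_)
    simp only [fderiv_negChar_single]
    ring
  · simp only [fderiv_negChar_single, mul_assoc]
    exact (hc.const_mul _)

/-- Integration by parts n times: multiplication by (iξ_j)^n on the Fourier side is ∂_j^n on the
other, and characters have modulus one. -/
lemma abs_pow_mul_norm_integral_negChar_le (ξ : Rd d) (j : Fin d) {g : Rd d → ℂ}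
    (hg : ContDiff ℝ ∞ g) (hi : ∀ n, Integrable ((pd j)^[n] g)) (n : ℕ) :
    |ξ j| ^ n * ‖∫ y, negChar ξ y * g y‖ ≤ ∫ y, ‖(pd j)^[n] g y‖ := by
  have h : ∀ n, ∫ y, negChar ξ y * (pd j)^[n] g y =
      (Complex.I * (ξ j : ℂ)) ^ n * ∫ y, negChar ξ y * g y := by
    intro n
    induction n with
    | zero => simp
    | succ n ih =>
      have h1 := hi (n + 1)
      rw [Function.iterate_succ_apply'] at h1 ⊢
      rw [integral_negChar_mul_pd ξ j (contDiff_pd_iterate hg j n) (hi n) h1, ih, pow_succ]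
      ring
  have h2 : |ξ j| ^ n * ‖∫ y, negChar ξ y * g y‖ = ‖∫ y, negChar ξ y * (pd j)^[n] g y‖ := by
    rw [h, norm_mul, norm_pow, norm_mul, Complex.norm_I, one_mul, Complex.norm_real,
      Real.norm_eq_abs]
  rw [h2]
  refine (norm_integral_le_integral_norm _).trans (le_of_eq ?_)
  simp [norm_negChar]

/-! ### Decay of the Gabor transform of a test function -/

/-- The Gabor transform `∫ φ(y) \overline{M_ξ T_x ψ(y)} dy` at `z = (x, ξ)`. -/
def gabor (ψ φ : Rd d → ℂ) (z : Rd d × Rd d) : ℂ := ∫ y, φ y * starRingEnd ℂ (tfFun ψ z y)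

lemma conj_tfFun (ψ : Rd d → ℂ) (z : Rd d × Rd d) (y : Rd d) :
    starRingEnd ℂ (tfFun ψ z y) = negChar z.2 y * starRingEnd ℂ (ψ (y - z.1)) := by
  rw [tfFun_apply, map_mul, ← Complex.exp_conj, negChar]
  congr 2
  simp

/-- The product of `φ` with the conjugate of `T_x ψ`. -/
def windowed (ψ φ : Rd d → ℂ) (x : Rd d) : Rd d → ℂ :=
  φ * fun y => starRingEnd ℂ (translate x ψ y)

lemma gabor_eq (ψ φ : Rd d → ℂ) (z : Rd d × Rd d) :
    gabor ψ φ z = ∫ y, negChar z.2 y * windowed ψ φ z.1 y := by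
  simp only [gabor, conj_tfFun, windowed, Pi.mul_apply, translate]
  congr 1
  funext y
  ring

lemma contDiff_windowed {ψ φ : Rd d → ℂ} (hψ : ContDiff ℝ ∞ ψ) (hφ : ContDiff ℝ ∞ φ) (x : Rd d) :
    ContDiff ℝ ∞ (windowed ψ φ x) :=
  hφ.mul (contDiff_conj (contDiff_translate x hψ))

lemma GSBound.nonneg {A h k : ℝ} {f : Rd d → ℂ} (hf : GSBound t s A h k f) : 0 ≤ A := by
  have := hf.2 0 0 0
  simp only [mlen_zero, mfact_zero, monom_zero, pderiv_zero, pow_zero, Nat.cast_one,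
    Real.one_rpow, mul_one, abs_one, one_mul] at this
  exact (norm_nonneg _).trans this

/-- φ decays away from 0 and T_x ψ away from x, so their product is small when x is large. The
parameter h is fixed by a before k is given, because k is needed to set the decay rate in frequency
independently. -/
lemma GelfandShilov.exists_norm_pd_iterate_windowed_le (ht : 0 < t) (hs : 0 < s)
    (ψ : GelfandShilov d t s) {a : ℝ} (ha : 0 < a) :
    ∃ h : ℝ, 0 < h ∧ ∀ k : ℝ, 0 < k → ∃ C : ℝ, 0 ≤ C ∧ ∀ (φ : Rd d → ℂ) (A : ℝ),
      GSBound t s A h k φ → ∀ (j : Fin d) (n : ℕ) (x y : Rd d),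
      ‖(pd j)^[n] (windowed ψ φ x) y‖ ≤ C * A * Real.exp (-(a * ‖x‖ ^ (1 / t))) *
        ((2 * k) ^ n * (n.factorial : ℝ) ^ s) * Real.exp (-(1 * ‖y‖ ^ (1 / t))) := by
  have hp : 0 ≤ 1 / t := by positivity
  -- The first summand pays for |x|^{1/t} ≤ 2^{1/t}(|y|^{1/t} + |y-x|^{1/t}); the extra 1 leaves
  -- e^{-|y|^{1/t}}, which makes the product integrable in y.
  set a' := 2 ^ (1 / t) * a + 1 with ha'
  obtain ⟨h, hh, hle⟩ := exists_norm_pderiv_le_of_gsBound d s ht (a := a') (by positivity)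
  refine ⟨h, hh, fun k hk => ?_⟩
  obtain ⟨B, hB, hψ⟩ := ψ.exists_gsBound hh hk
  refine ⟨2 ^ t * 2 ^ t * B, by positivity, fun φ A hφ j n x y => ?_⟩
  have hA := hφ.nonneg
  have h1 : ∀ n, ‖(pd j)^[n] φ y‖ ≤ 2 ^ t * A * Real.exp (-(a' * ‖y‖ ^ (1 / t))) *
      (k ^ n * (n.factorial : ℝ) ^ s) := by
    intro n
    have := hle A k φ hφ (Function.update 0 j n) y
    rw [pderiv_update_zero j n hφ.1, mlen_update, mfact_update, update_zero_zero, mlen_zero,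
      mfact_zero, add_zero, mul_one] at this
    refine this.trans (le_of_eq (by ring))
  have h2 : ∀ n, ‖(pd j)^[n] (fun y => starRingEnd ℂ (translate x ψ y)) y‖ ≤
      2 ^ t * B * Real.exp (-(a' * ‖y - x‖ ^ (1 / t))) * (k ^ n * (n.factorial : ℝ) ^ s) := by
    intro n
    have := hle B k ψ hψ (Function.update 0 j n) (y - x)
    rw [pderiv_update_zero j n hψ.1, mlen_update, mfact_update, update_zero_zero, mlen_zero,
      mfact_zero, add_zero, mul_one] at this
    rw [pd_iterate_conj j (contDiff_translate x hψ.1), pd_iterate_translate]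
    simp only [translate, RCLike.norm_conj]
    refine this.trans (le_of_eq (by ring))
  refine (norm_pd_iterate_mul_le j y n _ _ hφ.1 (contDiff_conj (contDiff_translate x hψ.1))).trans ?_
  refine (sum_choose_mul_le hk.le (by positivity) hs
    (fun _ => norm_nonneg _) h1 h2 n).trans ?_
  have h3 : Real.exp (-(a' * ‖y‖ ^ (1 / t))) * Real.exp (-(a' * ‖y - x‖ ^ (1 / t))) ≤
      Real.exp (-(a * ‖x‖ ^ (1 / t))) * Real.exp (-(1 * ‖y‖ ^ (1 / t))) := by
    rw [← Real.exp_add, ← Real.exp_add, Real.exp_le_exp]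
    have h4 := norm_rpow_le_two_rpow_mul hp x y
    have h5 : 0 ≤ ‖y - x‖ ^ (1 / t) := by positivity
    have h6 := mul_le_mul_of_nonneg_left h4 ha.le
    rw [ha']
    nlinarith
  calc _ = 2 ^ t * 2 ^ t * B * A * ((2 * k) ^ n * (n.factorial : ℝ) ^ s) *
        (Real.exp (-(a' * ‖y‖ ^ (1 / t))) * Real.exp (-(a' * ‖y - x‖ ^ (1 / t)))) := by ring
    _ ≤ 2 ^ t * 2 ^ t * B * A * ((2 * k) ^ n * (n.factorial : ℝ) ^ s) *
        (Real.exp (-(a * ‖x‖ ^ (1 / t))) * Real.exp (-(1 * ‖y‖ ^ (1 / t)))) := by gcongr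
    _ = _ := by ring

/-- Decay in x is that of the windowed product; decay in ξ follows by integrating by parts to every
order. The bound is uniform in φ and linear in A, because it is later applied to φ = M_ξ T_x ψ with
A depending on (x, ξ). -/
lemma GelfandShilov.exists_norm_gabor_le (ht : 0 < t) (hs : 0 < s)
    (ψ : GelfandShilov d t s) {a : ℝ} (ha : 0 < a) :
    ∃ h k C : ℝ, 0 < h ∧ 0 < k ∧ 0 ≤ C ∧ ∀ (φ : Rd d → ℂ) (A : ℝ), GSBound t s A h k φ →
      ∀ z, ‖gabor ψ φ z‖ ≤ C * A * Real.exp (-(a * phaseWeight t s z)) := by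
  obtain ⟨h, hh, H⟩ := ψ.exists_norm_pd_iterate_windowed_le ht hs ha
  -- The factor d + 1 comes from passing to the largest coordinate and the factor 2 from Leibniz'
  -- rule.
  obtain ⟨k, hk, he⟩ := exists_rpow_div_eq (c := ((d : ℝ) + 1) * 2) hs ha (by positivity)
  obtain ⟨C, hC, H⟩ := H k hk
  have hI := integrable_exp_neg_mul_norm_rpow (d := d) one_pos (one_div_pos.2 ht)
  set I := ∫ y : Rd d, Real.exp (-(1 * ‖y‖ ^ (1 / t))) with hIdef
  have hI0 : 0 ≤ I := integral_nonneg fun _ => (Real.exp_pos _).le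
  -- the case `n = 0` of the estimate does not involve a coordinate, so it is recorded separately
  obtain ⟨C₀, hC₀, H₀⟩ : ∃ C₀ : ℝ, 0 ≤ C₀ ∧ ∀ (φ : Rd d → ℂ) (A : ℝ),
      GSBound t s A h k φ → ∀ (x y : Rd d), ‖windowed ψ φ x y‖ ≤
        C₀ * A * Real.exp (-(a * ‖x‖ ^ (1 / t))) * Real.exp (-(1 * ‖y‖ ^ (1 / t))) := by
    rcases isEmpty_or_nonempty (Fin d) with hd | ⟨⟨j⟩⟩
    · refine ⟨‖ψ.1 0‖, norm_nonneg _, fun φ A hφ x y => ?_⟩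
      have hz : ∀ v : Rd d, v = 0 := fun v => by ext i; exact isEmptyElim i
      have h1 : ‖φ y‖ ≤ A := by
        simpa [mlen_zero, mfact_zero, monom_zero, pderiv_zero] using hφ.2 0 0 y
      have hp : 1 / t ≠ 0 := by positivity
      have hA := hφ.nonneg
      rw [hz x, hz y]
      rw [hz y] at h1
      simp only [windowed, Pi.mul_apply, translate, norm_mul, RCLike.norm_conj, sub_zero, norm_zero,
        Real.zero_rpow hp, mul_zero, neg_zero, Real.exp_zero, mul_one]
      rw [mul_comm]
      gcongr
    · refine ⟨C, hC, fun φ A hφ x y => ?_⟩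
      simpa using H φ A hφ j 0 x y
  refine ⟨h, k, 2 ^ s * (max C C₀ * I), hh, hk, by positivity, fun φ A hφ z => ?_⟩
  have hA := hφ.nonneg
  have hsm := contDiff_windowed ψ.contDiff hφ.1 z.1
  have hmax : ∀ c ≤ max C C₀, c * A * Real.exp (-(a * ‖z.1‖ ^ (1 / t))) * I ≤
      max C C₀ * A * Real.exp (-(a * ‖z.1‖ ^ (1 / t))) * I := fun c hc => by gcongr
  have hint : ∀ (j : Fin d) n, Integrable ((pd j)^[n] (windowed ψ φ z.1)) := fun j n =>
    (hI.const_mul _).mono' (contDiff_pd_iterate hsm j n).continuous.aestronglyMeasurable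
      (Filter.Eventually.of_forall fun y => H φ A hφ j n z.1 y)
  have key := le_exp_neg_of_forall_coord (c := 2 * k) (τ := s) (B := ‖gabor ψ φ z‖)
    (A := max C C₀ * A * Real.exp (-(a * ‖z.1‖ ^ (1 / t))) * I) (by positivity) hs z.2
    (norm_nonneg _) ?_ ?_
  · refine key.trans (le_of_eq ?_)
    rw [← mul_assoc ((d : ℝ) + 1) 2 k, he _ (norm_nonneg _), phaseWeight, mul_add, neg_add,
      Real.exp_add]
    ring
  · refine le_trans ?_ (hmax C₀ (le_max_right _ _))
    rw [gabor_eq, hIdef, ← integral_const_mul]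
    refine norm_integral_le_of_norm_le (hI.const_mul _) (Filter.Eventually.of_forall fun y => ?_)
    rw [norm_mul, norm_negChar, one_mul]
    exact H₀ φ A hφ z.1 y
  · intro j n
    rw [gabor_eq]
    refine (abs_pow_mul_norm_integral_negChar_le z.2 j hsm (hint j) n).trans ?_
    calc ∫ y, ‖(pd j)^[n] (windowed ψ φ z.1) y‖
        ≤ ∫ y : Rd d, C * A * Real.exp (-(a * ‖z.1‖ ^ (1 / t))) *
          ((2 * k) ^ n * (n.factorial : ℝ) ^ s) * Real.exp (-(1 * ‖y‖ ^ (1 / t))) :=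
          integral_mono (hint j n).norm (hI.const_mul _) fun y => H φ A hφ j n z.1 y
      _ = C * A * Real.exp (-(a * ‖z.1‖ ^ (1 / t))) * I *
          ((2 * k) ^ n * (n.factorial : ℝ) ^ s) := by rw [integral_const_mul]; ring
      _ ≤ _ := by
        have := hmax C (le_max_left _ _)
        gcongr

lemma GelfandShilov.exists_norm_gabor_le' (ht : 0 < t) (hs : 0 < s)
    (ψ φ : GelfandShilov d t s) {a : ℝ} (ha : 0 < a) :
    ∃ C : ℝ, 0 ≤ C ∧ ∀ z, ‖gabor ψ φ z‖ ≤ C * Real.exp (-(a * phaseWeight t s z)) := by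
  obtain ⟨h, k, C, hh, hk, hC, H⟩ := ψ.exists_norm_gabor_le ht hs ha
  obtain ⟨A, hA, hφ⟩ := φ.exists_gsBound hh hk
  exact ⟨C * A, by positivity, H φ A hφ⟩

/-! ### Differentiation of superpositions of smooth functions -/

lemma pdList_pd (i : Fin d) {f : Rd d → ℂ} (hf : ContDiff ℝ ∞ f) (β : Fin d → ℕ)
    (l : List (Fin d)) : pdList l β (pd i f) = pd i (pdList l β f) := by
  induction l with
  | nil => rfl
  | cons j l ih =>
    have hc := contDiff_pdList hf l β
    simp only [pdList, List.foldr_cons] at ih hc ⊢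
    rw [ih]
    exact pd_iterate_comm hc j i (β j) 1

lemma pderiv_pd (i : Fin d) {f : Rd d → ℂ} (hf : ContDiff ℝ ∞ f) (β : Fin d → ℕ) :
    pderiv β (pd i f) = pderiv (Function.update β i (β i + 1)) f := by
  have h1 : pderiv β (pd i f) = pd i (pderiv β f) := pdList_pd i hf β _
  rw [h1, pderiv_split i β hf, pderiv_split i (Function.update β i (β i + 1)) hf,
    Function.update_self, Function.update_idem, Function.iterate_succ_apply']

lemma sum_mul_fderiv_single (L : Rd d →L[ℝ] ℂ) (v : Rd d) :
    L v = ∑ i, (v i : ℂ) * L (EuclideanSpace.single i (1 : ℝ)) := by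
  have e : (∑ i, v i • EuclideanSpace.single i (1 : ℝ) : Rd d) = v := by
    ext i
    simp [Finset.sum_apply, Pi.single_apply]
  conv_lhs => rw [← e]
  simp [map_sum]

lemma norm_le_sum_norm_single (L : Rd d →L[ℝ] ℂ) :
    ‖L‖ ≤ ∑ i, ‖L (EuclideanSpace.single i (1 : ℝ))‖ := by
  refine L.opNorm_le_bound (Finset.sum_nonneg fun _ _ => norm_nonneg _) fun v => ?_
  rw [sum_mul_fderiv_single L v, Finset.sum_mul]
  refine (norm_sum_le _ _).trans (Finset.sum_le_sum fun i _ => ?_)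
  rw [norm_mul, mul_comm]
  have : ‖(v i : ℂ)‖ ≤ ‖v‖ := by simpa using PiLp.norm_apply_le v i
  gcongr

section Synthesis

variable {μ : Measure (Rd d × Rd d)}

/-- The superposition `y ↦ ∫ G(z) g_z(y) dμ(z)`. -/
def synth (μ : Measure (Rd d × Rd d)) (G : Rd d × Rd d → ℂ) (g : Rd d × Rd d → Rd d → ℂ) (y : Rd d) : ℂ := ∫ z, G z * g z y ∂μ

/-- The family `g_z` is jointly smooth, and the derivatives of `G(z) g_z` in the variable of
`Rd d` are dominated, locally uniformly, by integrable functions. -/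
structure SynthFamily (μ : Measure (Rd d × Rd d)) (G : Rd d × Rd d → ℂ) (g : Rd d × Rd d → Rd d → ℂ) : Prop where
  contDiff : ContDiff ℝ ∞ (fun p : (Rd d × Rd d) × Rd d => g p.1 p.2)
  aestronglyMeasurable : AEStronglyMeasurable G μ
  bound : ∀ (β : Fin d → ℕ) (ρ : ℝ), ∃ b : Rd d × Rd d → ℝ, Integrable b μ ∧
    ∀ z y, ‖y‖ ≤ ρ → ‖G z‖ * ‖pderiv β (g z) y‖ ≤ b z

namespace SynthFamily

variable {G : Rd d × Rd d → ℂ} {g : Rd d × Rd d → Rd d → ℂ}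

lemma contDiff_slice (h : ContDiff ℝ ∞ (fun p : (Rd d × Rd d) × Rd d => g p.1 p.2)) (z : Rd d × Rd d) :
    ContDiff ℝ ∞ (g z) := h.comp (contDiff_const.prodMk contDiff_id)

lemma fderiv_slice_apply (h : ContDiff ℝ ∞ (fun p : (Rd d × Rd d) × Rd d => g p.1 p.2)) (z : Rd d × Rd d) (y v : Rd d) :
    fderiv ℝ (g z) y v = fderiv ℝ (fun p : (Rd d × Rd d) × Rd d => g p.1 p.2) (z, y) (0, v) := by
  have h1 := (h.differentiable (by simp) (z, y)).hasFDerivAt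
  have h2 : HasFDerivAt (fun y : Rd d => (z, y)) (ContinuousLinearMap.inr ℝ (Rd d × Rd d) (Rd d)) y :=
    hasFDerivAt_prodMk_right z y
  have h3 : fderiv ℝ (g z) y = _ := (h1.comp y h2).fderiv
  rw [h3]
  simp

/-- The domination is required for all multi-indices at once, so that differentiation merely shifts
the index and stays within the class; this makes the inductions below possible. -/
lemma pd (h : SynthFamily μ G g) (i : Fin d) : SynthFamily μ G (fun z => GS.pd i (g z)) where
  contDiff := by
    have e : (fun p : (Rd d × Rd d) × Rd d => GS.pd i (g p.1) p.2) = fun p =>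
        fderiv ℝ (fun p : (Rd d × Rd d) × Rd d => g p.1 p.2) p (0, EuclideanSpace.single i (1 : ℝ)) := by
      funext p
      exact fderiv_slice_apply h.contDiff p.1 p.2 _
    rw [e]
    exact (h.contDiff.fderiv_right (m := ∞) (by simp)).clm_apply contDiff_const
  aestronglyMeasurable := h.aestronglyMeasurable
  bound β ρ := by
    obtain ⟨b, hb, hle⟩ := h.bound (Function.update β i (β i + 1)) ρ
    refine ⟨b, hb, fun z y hy => ?_⟩
    rw [pderiv_pd i (contDiff_slice h.contDiff z)]
    exact hle z y hy

lemma aestronglyMeasurable_mul (h : SynthFamily μ G g) (y : Rd d) :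
    AEStronglyMeasurable (fun z => G z * g z y) μ :=
  h.aestronglyMeasurable.mul
    (h.contDiff.continuous.comp (continuous_id.prodMk continuous_const)).aestronglyMeasurable

lemma integrable (h : SynthFamily μ G g) (y : Rd d) : Integrable (fun z => G z * g z y) μ := by
  obtain ⟨b, hb, hle⟩ := h.bound 0 ‖y‖
  refine hb.mono' (h.aestronglyMeasurable_mul y) (Filter.Eventually.of_forall fun z => ?_)
  rw [norm_mul]
  simpa [pderiv_zero] using hle z y le_rfl

lemma exists_fderiv_bound (h : SynthFamily μ G g) (ρ : ℝ) : ∃ b : Rd d × Rd d → ℝ, Integrable b μ ∧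
    ∀ z y, ‖y‖ ≤ ρ → ‖G z • fderiv ℝ (g z) y‖ ≤ b z := by
  choose b hb hle using fun i : Fin d => h.bound (Function.update 0 i 1) ρ
  refine ⟨fun z => ∑ i, b i z, integrable_finsetSum _ fun i _ => hb i, fun z y hy => ?_⟩
  rw [norm_smul]
  calc ‖G z‖ * ‖fderiv ℝ (g z) y‖
      ≤ ‖G z‖ * ∑ i, ‖fderiv ℝ (g z) y (EuclideanSpace.single i (1 : ℝ))‖ := by
        gcongr; exact norm_le_sum_norm_single _
    _ = ∑ i, ‖G z‖ * ‖fderiv ℝ (g z) y (EuclideanSpace.single i (1 : ℝ))‖ := Finset.mul_sum _ _ _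
    _ ≤ ∑ i, b i z := Finset.sum_le_sum fun i _ => by
        have := hle i z y hy
        rwa [pderiv_update_zero i 1 (contDiff_slice h.contDiff z)] at this

lemma continuous_fderiv_slice (h : SynthFamily μ G g) (y : Rd d) :
    Continuous fun z => fderiv ℝ (g z) y := by
  have e : (fun z => fderiv ℝ (g z) y) = fun z =>
      (fderiv ℝ (fun p : (Rd d × Rd d) × Rd d => g p.1 p.2) (z, y)).comp
        (ContinuousLinearMap.inr ℝ (Rd d × Rd d) (Rd d)) := by
    funext z
    ext v
    rw [fderiv_slice_apply h.contDiff]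
    simp
  rw [e]
  exact (((h.contDiff.continuous_fderiv (by simp)).comp
    (continuous_id.prodMk continuous_const)).clm_comp continuous_const)

lemma aestronglyMeasurable_fderiv (h : SynthFamily μ G g) (y : Rd d) :
    AEStronglyMeasurable (fun z => G z • fderiv ℝ (g z) y) μ :=
  h.aestronglyMeasurable.smul (h.continuous_fderiv_slice y).aestronglyMeasurable

lemma hasFDerivAt (h : SynthFamily μ G g) (y : Rd d) :
    HasFDerivAt (synth μ G g) (∫ z, G z • fderiv ℝ (g z) y ∂μ) y := by
  -- The radius covers the unit ball around y, on which the derivatives must be dominated.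
  obtain ⟨b, hb, hle⟩ := h.exists_fderiv_bound (‖y‖ + 1)
  refine hasFDerivAt_integral_of_dominated_of_fderiv_le (𝕜 := ℝ) (bound := b)
    (F' := fun y z => G z • fderiv ℝ (g z) y) (Metric.ball_mem_nhds y one_pos)
    (Filter.Eventually.of_forall fun y => h.aestronglyMeasurable_mul y) (h.integrable y)
    (h.aestronglyMeasurable_fderiv y) (Filter.Eventually.of_forall fun z x hx => hle z x ?_) hb
    (Filter.Eventually.of_forall fun z x _ => ?_)
  · rw [Metric.mem_ball, dist_eq_norm] at hx
    have := norm_le_norm_add_norm_sub' x y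
    linarith
  · exact (((contDiff_slice h.contDiff z).differentiable (by simp) x).hasFDerivAt).const_mul (G z)

lemma pd_synth (h : SynthFamily μ G g) (i : Fin d) :
    GS.pd i (synth μ G g) = synth μ G (fun z => GS.pd i (g z)) := by
  funext y
  obtain ⟨b, hb, hle⟩ := h.exists_fderiv_bound ‖y‖
  have hi : Integrable (fun z => G z • fderiv ℝ (g z) y) μ :=
    hb.mono' (h.aestronglyMeasurable_fderiv y) (Filter.Eventually.of_forall fun z => hle z y le_rfl)
  simp only [GS.pd, synth, (h.hasFDerivAt y).fderiv]
  rw [ContinuousLinearMap.integral_apply hi]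
  simp

/-- Induction on n over all families simultaneously: the partial derivatives of a superposition are
superpositions of the differentiated families. -/
lemma contDiff_synth_nat (n : ℕ) : ∀ {g : Rd d × Rd d → Rd d → ℂ}, SynthFamily μ G g →
    ContDiff ℝ n (synth μ G g) := by
  induction n with
  | zero =>
    intro g h
    exact contDiff_zero.2 (continuous_iff_continuousAt.2 fun y => (h.hasFDerivAt y).continuousAt)
  | succ n ih =>
    intro g h
    rw [Nat.cast_succ]
    refine contDiff_succ_iff_fderiv.2 ⟨fun y => (h.hasFDerivAt y).differentiableAt,
      fun hn => absurd hn (by simp), ?_⟩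
    refine contDiff_clm_apply_iff.2 fun v => ?_
    have e : (fun y => fderiv ℝ (synth μ G g) y v) =
        fun y => ∑ i, (v i : ℂ) * synth μ G (fun z => GS.pd i (g z)) y := by
      funext y
      rw [sum_mul_fderiv_single]
      refine Finset.sum_congr rfl fun i _ => ?_
      rw [← h.pd_synth i]
      rfl
    rw [e]
    exact ContDiff.sum fun i _ => contDiff_const.mul (ih (h.pd i))

lemma contDiff_synth (h : SynthFamily μ G g) : ContDiff ℝ ∞ (synth μ G g) :=
  contDiff_infty.2 fun n => contDiff_synth_nat n h

lemma pd_iterate (h : SynthFamily μ G g) (i : Fin d) (n : ℕ) :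
    SynthFamily μ G (fun z => (GS.pd i)^[n] (g z)) ∧
      (GS.pd i)^[n] (synth μ G g) = synth μ G (fun z => (GS.pd i)^[n] (g z)) := by
  induction n with
  | zero => exact ⟨h, rfl⟩
  | succ n ih =>
    simp only [Function.iterate_succ_apply']
    exact ⟨ih.1.pd i, by rw [ih.2, ih.1.pd_synth i]⟩

lemma pdList (h : SynthFamily μ G g) (β : Fin d → ℕ) (l : List (Fin d)) :
    SynthFamily μ G (fun z => GS.pdList l β (g z)) ∧
      GS.pdList l β (synth μ G g) = synth μ G (fun z => GS.pdList l β (g z)) := by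
  induction l with
  | nil => exact ⟨h, rfl⟩
  | cons i l ih =>
    simp only [GS.pdList, List.foldr_cons] at ih ⊢
    rw [ih.2]
    exact ih.1.pd_iterate i (β i)

lemma pderiv_synth (h : SynthFamily μ G g) (β : Fin d → ℕ) :
    pderiv β (synth μ G g) = synth μ G (fun z => pderiv β (g z)) := (h.pdList β _).2

end SynthFamily

end Synthesis

/-- Superpositions of time-frequency shifts with a density of exponential decay in frequency and
at most exponential growth in space. -/
theorem synth_tfFun (ht : 0 < t) (hs : 0 < s) (ψ : GelfandShilov d t s) {G : Rd d × Rd d → ℂ}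
    (hG : AEStronglyMeasurable G) {C R : ℝ} (hR : 0 ≤ R)
    (hGle : ∀ z, ‖G z‖ ≤
      C * (Real.exp (-((s * d + 1) * ‖z.2‖ ^ (1 / s))) * Real.exp (R * ‖z.1‖ ^ (1 / t)))) :
    SynthFamily volume G (tfFun ψ) ∧ ∃ C₁ C₂ r : ℝ, 0 ≤ C₁ ∧ 0 ≤ C₂ ∧ 0 < r ∧
      (∀ z y, ‖G z‖ * ‖tfFun ψ z y‖ ≤
        C₁ * Real.exp (r * ‖y‖ ^ (1 / t)) * Real.exp (-(1 * phaseWeight t s z))) ∧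
      ∀ β y, ‖pderiv β (synth volume G (tfFun ψ)) y‖ ≤
        C₂ * ((2 ^ d) ^ mlen β * (mfact β : ℝ) ^ s) * Real.exp (r * ‖y‖ ^ (1 / t)) := by
  have hp : 0 ≤ 1 / t := by positivity
  have hC : 0 ≤ C := by
    by_contra! hC
    have h1 := hGle 0
    have h2 := norm_nonneg (G 0)
    have h3 : 0 < Real.exp (-((s * d + 1) * ‖(0 : Rd d × Rd d).2‖ ^ (1 / s))) *
      Real.exp (R * ‖(0 : Rd d × Rd d).1‖ ^ (1 / t)) := by positivity
    nlinarith
  -- With this rate, R|x|^{1/t} - a|y-x|^{1/t} ≤ a|y|^{1/t} - |x|^{1/t}. In frequency, s d + 1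
  -- against the growth s d leaves e^{-|ξ|^{1/s}}. What remains is integrable over phase space.
  set a := 2 ^ (1 / t) * (R + 1) with ha
  have ha0 : 0 < a := by positivity
  obtain ⟨B, hB, hle⟩ := ψ.exists_norm_pderiv_tfFun_le ht hs ha0
  have hpt : ∀ z β y, ‖G z‖ * ‖pderiv β (tfFun ψ z) y‖ ≤
      C * B * ((2 ^ d) ^ mlen β * (mfact β : ℝ) ^ s) * Real.exp (a * ‖y‖ ^ (1 / t)) *
        Real.exp (-(1 * phaseWeight t s z)) := by
    intro z β y
    have h1 : Real.exp (-((s * d + 1) * ‖z.2‖ ^ (1 / s))) * Real.exp (R * ‖z.1‖ ^ (1 / t)) *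
        (Real.exp (s * d * ‖z.2‖ ^ (1 / s)) * Real.exp (-(a * ‖y - z.1‖ ^ (1 / t)))) ≤
        Real.exp (a * ‖y‖ ^ (1 / t)) * Real.exp (-(1 * phaseWeight t s z)) := by
      rw [← Real.exp_add, ← Real.exp_add, ← Real.exp_add, ← Real.exp_add, Real.exp_le_exp]
      have h2 := norm_rpow_le_two_rpow_mul hp z.1 y
      have h3 := mul_le_mul_of_nonneg_left h2 (by linarith : (0 : ℝ) ≤ R + 1)
      unfold phaseWeight
      rw [ha]
      nlinarith
    calc ‖G z‖ * ‖pderiv β (tfFun ψ z) y‖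
        ≤ (C * (Real.exp (-((s * d + 1) * ‖z.2‖ ^ (1 / s))) * Real.exp (R * ‖z.1‖ ^ (1 / t)))) *
          (B * ((2 ^ d) ^ mlen β * (mfact β : ℝ) ^ s) *
            (Real.exp (s * d * ‖z.2‖ ^ (1 / s)) * Real.exp (-(a * ‖y - z.1‖ ^ (1 / t))))) :=
          mul_le_mul (hGle z) (hle z β y) (norm_nonneg _) (by positivity)
      _ = C * B * ((2 ^ d) ^ mlen β * (mfact β : ℝ) ^ s) *
          (Real.exp (-((s * d + 1) * ‖z.2‖ ^ (1 / s))) * Real.exp (R * ‖z.1‖ ^ (1 / t)) *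
            (Real.exp (s * d * ‖z.2‖ ^ (1 / s)) * Real.exp (-(a * ‖y - z.1‖ ^ (1 / t))))) := by ring
      _ ≤ C * B * ((2 ^ d) ^ mlen β * (mfact β : ℝ) ^ s) *
          (Real.exp (a * ‖y‖ ^ (1 / t)) * Real.exp (-(1 * phaseWeight t s z))) := by gcongr
      _ = _ := by ring
  have hI := integrable_exp_neg_mul_phaseWeight (d := d) ht hs one_pos
  set I := ∫ z : Rd d × Rd d, Real.exp (-(1 * phaseWeight t s z)) with hIdef
  have hI0 : 0 ≤ I := integral_nonneg fun _ => (Real.exp_pos _).le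
  have hS : SynthFamily volume G (tfFun ψ) := by
    refine ⟨contDiff_tfFun ψ.contDiff, hG, fun β ρ => ?_⟩
    refine ⟨fun z => C * B * ((2 ^ d) ^ mlen β * (mfact β : ℝ) ^ s) *
      Real.exp (a * ρ ^ (1 / t)) * Real.exp (-(1 * phaseWeight t s z)), hI.const_mul _,
      fun z y hy => (hpt z β y).trans ?_⟩
    beta_reduce
    gcongr
  refine ⟨hS, C * B, C * B * I, a, by positivity, by positivity, ha0, fun z y => ?_, fun β y => ?_⟩
  · simpa [mlen_zero, mfact_zero, pderiv_zero] using hpt z 0 y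
  rw [hS.pderiv_synth]
  have h1 := norm_integral_le_of_norm_le (f := fun z => G z * pderiv β (tfFun ψ z) y)
    (hI.const_mul (C * B * ((2 ^ d) ^ mlen β * (mfact β : ℝ) ^ s) * Real.exp (a * ‖y‖ ^ (1 / t))))
    (Filter.Eventually.of_forall fun z => by rw [norm_mul]; exact hpt z β y)
  rw [integral_const_mul] at h1
  refine h1.trans (le_of_eq ?_)
  ring

/-! ### The inversion formula -/

open scoped FourierTransform in
-- Fourier inversion in the normalisation without 2π in the exponent; the dilation by 2π produces
-- the factor (2π)^d.
lemma integral_exp_mul_integral_negChar {g : Rd d → ℂ} (hc : Continuous g) (hg : Integrable g)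
    (hĝ : Integrable fun ξ => ∫ y, negChar ξ y * g y) (y : Rd d) :
    ∫ ξ, (∫ v, negChar ξ v * g v) * Complex.exp (Complex.I * ((inner ℝ y ξ : ℝ) : ℂ)) =
      (((2 * Real.pi) ^ d : ℝ) : ℂ) * g y := by
  have hπ : (0 : ℝ) < 2 * Real.pi := by positivity
  have h1 : 𝓕 g = fun η => ∫ v, negChar ((2 * Real.pi) • η) v * g v := by
    funext η
    rw [Real.fourier_eq']
    congr 1
    funext v
    rw [negChar, smul_eq_mul, inner_smul_right]
    congr 2
    push_cast
    ring
  have h2 : Integrable (𝓕 g) := by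
    rw [h1]; exact hĝ.comp_smul hπ.ne'
  have h3 := hg.fourierInv_fourier_eq h2 (hc.continuousAt (x := y))
  rw [Real.fourierInv_eq', h1] at h3
  have h4 := Measure.integral_comp_smul (volume : Measure (Rd d)) (fun ξ => (∫ v, negChar ξ v * g v) *
    Complex.exp (Complex.I * ((inner ℝ y ξ : ℝ) : ℂ))) (2 * Real.pi)
  have h5 : ∫ η : Rd d, (∫ v, negChar ((2 * Real.pi) • η) v * g v) *
      Complex.exp (Complex.I * ((inner ℝ y ((2 * Real.pi) • η) : ℝ) : ℂ)) = g y := by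
    rw [← h3]
    congr 1
    funext η
    rw [smul_eq_mul, mul_comm, inner_smul_right, real_inner_comm]
    congr 2
    push_cast
    ring
  rw [h5, finrank_euclideanSpace_fin, abs_of_pos (by positivity)] at h4
  rw [h4, Complex.real_smul, ← mul_assoc, ← Complex.ofReal_mul, mul_inv_cancel₀ (by positivity),
    Complex.ofReal_one, one_mul]

lemma continuous_tfFun {f : Rd d → ℂ} (hf : ContDiff ℝ ∞ f) :
    Continuous (fun p : (Rd d × Rd d) × Rd d => tfFun f p.1 p.2) := (contDiff_tfFun hf).continuous

lemma stronglyMeasurable_gabor {ψ φ : Rd d → ℂ} (hψ : ContDiff ℝ ∞ ψ) (hφ : Continuous φ) :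
    StronglyMeasurable (gabor ψ φ) := by
  have h : Continuous (fun p : (Rd d × Rd d) × Rd d => φ p.2 * starRingEnd ℂ (tfFun ψ p.1 p.2)) :=
    (hφ.comp continuous_snd).mul (Complex.continuous_conj.comp (continuous_tfFun hψ))
  exact h.stronglyMeasurable.integral_prod_right'

lemma GelfandShilov.integrable_gabor (ht : 0 < t) (hs : 0 < s) (ψ φ : GelfandShilov d t s) :
    Integrable (gabor ψ φ) := by
  obtain ⟨C, hC, hle⟩ := ψ.exists_norm_gabor_le' ht hs φ one_pos
  exact ((integrable_exp_neg_mul_phaseWeight ht hs one_pos).const_mul C).mono'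
    (stronglyMeasurable_gabor ψ.contDiff φ.contDiff.continuous).aestronglyMeasurable
    (Filter.Eventually.of_forall hle)

lemma GelfandShilov.synthFamily_gabor (ht : 0 < t) (hs : 0 < s) (ψ φ : GelfandShilov d t s) :
    SynthFamily volume (gabor ψ φ) (tfFun ψ) := by
  obtain ⟨C, hC, hle⟩ := ψ.exists_norm_gabor_le' ht hs φ (a := s * d + 1) (by positivity)
  refine (synth_tfFun (C := C) (R := 0) ht hs ψ
    (stronglyMeasurable_gabor ψ.contDiff φ.contDiff.continuous).aestronglyMeasurable le_rfl
    fun z => (hle z).trans ?_).1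
  rw [zero_mul, Real.exp_zero, mul_one]
  have : 0 ≤ ‖z.1‖ ^ (1 / t) := by positivity
  gcongr
  unfold phaseWeight
  linarith

lemma GelfandShilov.integrable (ht : 0 < t) (φ : GelfandShilov d t s) : Integrable φ.1 := by
  obtain ⟨C, hC, hle⟩ := φ.exists_norm_le ht one_pos
  exact ((integrable_exp_neg_mul_norm_rpow one_pos (one_div_pos.2 ht)).const_mul C).mono'
    φ.contDiff.continuous.aestronglyMeasurable (Filter.Eventually.of_forall hle)

lemma GelfandShilov.exists_norm_le_const (ht : 0 < t) (φ : GelfandShilov d t s) :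
    ∃ C : ℝ, 0 ≤ C ∧ ∀ y, ‖φ.1 y‖ ≤ C := by
  obtain ⟨C, hC, hle⟩ := φ.exists_norm_le ht one_pos
  refine ⟨C, hC, fun y => (hle y).trans (mul_le_of_le_one_right hC ?_)⟩
  rw [Real.exp_le_one_iff, neg_nonpos]
  positivity

/-- The constant `(2π)^d ‖ψ‖²` of the inversion formula. -/
def gaborConst (ψ : Rd d → ℂ) : ℝ := (2 * Real.pi) ^ d * ∫ y, ‖ψ y‖ ^ 2

lemma GelfandShilov.gaborConst_pos (ht : 0 < t) {ψ : GelfandShilov d t s} (hψ : ψ ≠ 0) :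
    0 < gaborConst (ψ : Rd d → ℂ) := by
  obtain ⟨C, hC, hle⟩ := ψ.exists_norm_le_const ht
  have hcont := ψ.contDiff.continuous
  have hi : Integrable (fun y => ‖ψ.1 y‖ ^ 2) := by
    refine ((ψ.integrable ht).norm.const_mul C).mono'
      (hcont.norm.pow 2).aestronglyMeasurable (Filter.Eventually.of_forall fun y => ?_)
    rw [norm_pow, norm_norm, sq]
    have := hle y
    gcongr
  obtain ⟨y, hy⟩ : ∃ y, ψ.1 y ≠ 0 := by
    by_contra! h
    exact hψ (Subtype.ext (funext h))
  have : 0 < ∫ y, ‖ψ.1 y‖ ^ 2 :=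
    integral_pos_of_integrable_nonneg_nonzero (hcont.norm.pow 2) hi (fun y => by positivity)
      (x := y) (by positivity)
  unfold gaborConst
  positivity

/-- For fixed x, the ξ-integral is Fourier inversion for φ \overline{T_x ψ}. Evaluated at y and
multiplied by ψ(y-x), it gives (2π)^d φ(y)|ψ(y-x)|², and integration over x yields ‖ψ‖². -/
theorem GelfandShilov.synth_gabor (ht : 0 < t) (hs : 0 < s) (ψ φ : GelfandShilov d t s)
    (y : Rd d) : synth volume (gabor ψ φ) (tfFun ψ) y = (gaborConst ψ.1 : ℂ) * φ.1 y := by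
  have hψc := ψ.contDiff.continuous
  have hφc := φ.contDiff.continuous
  have hmeas := stronglyMeasurable_gabor ψ.contDiff hφc
  obtain ⟨C, hC, hle⟩ := ψ.exists_norm_gabor_le' ht hs φ one_pos
  have hint := (ψ.synthFamily_gabor ht hs φ).integrable y
  obtain ⟨B, hB, hBle⟩ := ψ.exists_norm_le_const ht
  have hslice : ∀ x : Rd d, ∫ ξ, gabor ψ φ (x, ξ) * tfFun ψ (x, ξ) y =
      (((2 * Real.pi) ^ d : ℝ) : ℂ) * φ.1 y * ((‖ψ.1 (y - x)‖ ^ 2 : ℝ) : ℂ) := by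
    intro x
    have hwc : Continuous (windowed ψ φ x) := (contDiff_windowed ψ.contDiff φ.contDiff x).continuous
    have hw : Integrable (windowed ψ φ x) := by
      refine ((φ.integrable ht).norm.const_mul B).mono' hwc.aestronglyMeasurable
        (Filter.Eventually.of_forall fun v => ?_)
      simp only [windowed, Pi.mul_apply, translate, norm_mul, RCLike.norm_conj]
      rw [mul_comm]
      have := hBle (v - x)
      gcongr
    have hV : Integrable fun ξ => ∫ v, negChar ξ v * windowed ψ φ x v := by
      have e : (fun ξ => ∫ v, negChar ξ v * windowed ψ φ x v) = fun ξ => gabor ψ φ (x, ξ) := by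
        funext ξ; rw [gabor_eq]
      rw [e]
      refine ((integrable_exp_neg_mul_norm_rpow one_pos (one_div_pos.2 hs)).const_mul C).mono'
        (hmeas.comp_measurable measurable_prodMk_left).aestronglyMeasurable
        (Filter.Eventually.of_forall fun ξ => (hle (x, ξ)).trans ?_)
      have : 0 ≤ ‖x‖ ^ (1 / t) := by positivity
      gcongr
      simp only [phaseWeight]
      linarith
    have h1 := integral_exp_mul_integral_negChar hwc hw hV y
    calc ∫ ξ, gabor ψ φ (x, ξ) * tfFun ψ (x, ξ) y
        = ∫ ξ, ((∫ v, negChar ξ v * windowed ψ φ x v) *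
          Complex.exp (Complex.I * ((inner ℝ y ξ : ℝ) : ℂ))) * ψ.1 (y - x) := by
          congr 1
          funext ξ
          rw [gabor_eq, tfFun_apply, mul_assoc]
      _ = _ := by
          rw [integral_mul_const, h1]
          simp only [windowed, Pi.mul_apply, translate]
          rw [mul_assoc, mul_assoc, mul_assoc, ← Complex.normSq_eq_conj_mul_self,
            Complex.normSq_eq_norm_sq]
  have e : synth volume (gabor ψ φ) (tfFun ψ) y =
      ∫ x, ∫ ξ, gabor ψ φ (x, ξ) * tfFun ψ (x, ξ) y := by
    rw [synth, Measure.volume_eq_prod]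
    rw [Measure.volume_eq_prod] at hint
    exact integral_prod _ hint
  rw [e]
  simp only [hslice]
  rw [integral_const_mul, integral_complex_ofReal,
    integral_sub_left_eq_self (fun x => ‖ψ.1 x‖ ^ 2) volume y, gaborConst]
  push_cast
  ring

/-! ### Representation of ultradistributions -/

lemma GSBound.gsSeminorm_le {A h : ℝ} (hh : 0 < h) {φ : GelfandShilov d t s}
    (hφ : GSBound t s A h h φ) {h' : {h : ℝ // 0 < h}} (hle : h ≤ h'.1) :
    gsSeminorm d t s h' φ ≤ A := by
  have hA := hφ.nonneg
  refine ciSup_le fun p => ?_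
  refine (div_le_iff₀ (gsDenom_pos t s h'.2 p.1 p.2.1)).2 ((hφ.2 p.1 p.2.1 p.2.2).trans ?_)
  rw [← pow_add]
  gcongr

/-- Continuity bounds u by finitely many of the norms ‖·‖_h. These increase as h decreases, so the
smallest h controls all of them. -/
lemma Ultradistribution.exists_norm_le (u : Ultradistribution d t s) :
    ∃ h C : ℝ, 0 < h ∧ 0 ≤ C ∧ ∀ (φ : GelfandShilov d t s) (A : ℝ), GSBound t s A h h φ →
      ‖u φ‖ ≤ C * A := by
  have hq : Continuous ((normSeminorm ℂ ℂ).comp u.toLinearMap) :=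
    continuous_norm.comp u.continuous
  obtain ⟨S, C, -, hle⟩ := Seminorm.bound_of_continuous withSeminorms_gs _ hq
  obtain ⟨h, hh, hS⟩ : ∃ h : ℝ, 0 < h ∧ ∀ h' ∈ S, h ≤ h'.1 := by
    clear hle
    induction S using Finset.induction_on with
    | empty => exact ⟨1, one_pos, by simp⟩
    | insert a S _ ih =>
      obtain ⟨h, hh, hS⟩ := ih
      refine ⟨min a.1 h, lt_min a.2 hh, fun h' hh' => ?_⟩
      rcases Finset.mem_insert.1 hh' with rfl | hm
      · exact min_le_left _ _
      · exact (min_le_right _ _).trans (hS h' hm)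
  refine ⟨h, C, hh, C.2, fun φ A hφ => (hle φ).trans ?_⟩
  have h1 : S.sup (gsSeminorm d t s) φ ≤ A :=
    Seminorm.finset_sup_apply_le hφ.nonneg fun h' hm => hφ.gsSeminorm_le hh (hS h' hm)
  exact mul_le_mul_of_nonneg_left h1 C.2

/-- A linear functional that is bounded with respect to a linear map into a Hilbert space is
represented by a vector of that space. -/
lemma exists_inner_eq_of_norm_le {V H : Type*} [AddCommGroup V] [Module ℂ V]
    [NormedAddCommGroup H] [InnerProductSpace ℂ H] [CompleteSpace H] (T : V →ₗ[ℂ] H)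
    (v : V →ₗ[ℂ] ℂ) {C : ℝ} (hv : ∀ x, ‖v x‖ ≤ C * ‖T x‖) : ∃ w : H, ∀ x, v x = inner ℂ w (T x) := by
  -- T is not assumed injective or of closed range. A linear section transports v to a bounded
  -- functional on the range, Hahn–Banach extends it to H, and Riesz represents it. The hypothesis
  -- also makes v vanish on ker T, so the choice of section is immaterial.
  obtain ⟨g, hg⟩ := T.rangeRestrict.exists_rightInverse_of_surjective T.range_rangeRestrict
  have hTg : ∀ y : LinearMap.range T, T (g y) = y := fun y =>
    congrArg Subtype.val (LinearMap.congr_fun hg y)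
  set f : LinearMap.range T →L[ℂ] ℂ := (v ∘ₗ g).mkContinuous C fun y => by
    have := hv (g y)
    rwa [hTg] at this
  obtain ⟨F, hF, -⟩ := exists_extension_norm_eq (LinearMap.range T) f
  refine ⟨(InnerProductSpace.toDual ℂ H).symm F, fun x => ?_⟩
  rw [InnerProductSpace.toDual_symm_apply]
  have h1 := hF ⟨T x, LinearMap.mem_range_self T x⟩
  rw [h1]
  have h2 : v x - v (g ⟨T x, LinearMap.mem_range_self T x⟩) = 0 := by
    rw [← map_sub, ← norm_le_zero_iff]
    refine (hv _).trans ?_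
    rw [map_sub, hTg, sub_self, norm_zero, mul_zero]
  exact sub_eq_zero.1 h2

lemma integrable_mul_conj_tfFun (ht : 0 < t) (ψ φ : GelfandShilov d t s) (z : Rd d × Rd d) :
    Integrable fun y => φ.1 y * starRingEnd ℂ (tfFun ψ z y) := by
  obtain ⟨B, hB, hBle⟩ := ψ.exists_norm_le_const ht
  refine (φ.integrable ht).mul_bdd (c := B) ?_ (Filter.Eventually.of_forall fun y => ?_)
  · exact (Complex.continuous_conj.comp ((continuous_tfFun ψ.contDiff).comp
      (continuous_const.prodMk continuous_id))).aestronglyMeasurable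
  · rw [RCLike.norm_conj, norm_tfFun]
    exact hBle _

/-- The Gabor transform multiplied by `e^{ρ(|x|^{1/t} + |ξ|^{1/s})}`. -/
def weightedGabor (t s ρ : ℝ) (ψ φ : Rd d → ℂ) (z : Rd d × Rd d) : ℂ :=
  (Real.exp (ρ * phaseWeight t s z) : ℂ) * gabor ψ φ z

lemma norm_weightedGabor (ρ : ℝ) (ψ φ : Rd d → ℂ) (z : Rd d × Rd d) :
    ‖weightedGabor t s ρ ψ φ z‖ = Real.exp (ρ * phaseWeight t s z) * ‖gabor ψ φ z‖ := by
  rw [weightedGabor, norm_mul, Complex.norm_real, Real.norm_of_nonneg (Real.exp_pos _).le]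

lemma continuous_exp_mul_phaseWeight (ht : 0 < t) (hs : 0 < s) (ρ : ℝ) :
    Continuous fun z : Rd d × Rd d => Real.exp (ρ * phaseWeight t s z) :=
  Real.continuous_exp.comp (continuous_const.mul (continuous_phaseWeight ht hs))

lemma stronglyMeasurable_weightedGabor (ht : 0 < t) (hs : 0 < s) (ρ : ℝ)
    (ψ φ : GelfandShilov d t s) : StronglyMeasurable (weightedGabor t s ρ (ψ : Rd d → ℂ) φ) :=
  (Complex.continuous_ofReal.comp
    (continuous_exp_mul_phaseWeight ht hs ρ)).stronglyMeasurable.mul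
    (stronglyMeasurable_gabor ψ.contDiff φ.contDiff.continuous)

lemma memLp_two_of_norm_le_exp (ht : 0 < t) (hs : 0 < s) {f : Rd d × Rd d → ℂ}
    (hf : StronglyMeasurable f) {C : ℝ}
    (hle : ∀ z, ‖f z‖ ≤ C * Real.exp (-(1 * phaseWeight t s z))) : MemLp f 2 := by
  rw [memLp_two_iff_integrable_sq_norm hf.aestronglyMeasurable]
  refine ((integrable_exp_neg_mul_phaseWeight ht hs two_pos).const_mul (C ^ 2)).mono'
    (hf.norm.pow 2).aestronglyMeasurable (Filter.Eventually.of_forall fun z => ?_)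
  rw [norm_pow, norm_norm]
  calc ‖f z‖ ^ 2 ≤ (C * Real.exp (-(1 * phaseWeight t s z))) ^ 2 := by gcongr; exact hle z
    _ = C ^ 2 * Real.exp (-(2 * phaseWeight t s z)) := by
      rw [mul_pow, ← Real.exp_nat_mul]
      push_cast
      ring_nf

lemma GelfandShilov.exists_norm_weightedGabor_le (ht : 0 < t) (hs : 0 < s) {ρ : ℝ} (hρ : 0 ≤ ρ)
    (ψ φ : GelfandShilov d t s) :
    ∃ C : ℝ, 0 ≤ C ∧ ∀ z, ‖weightedGabor t s ρ ψ φ z‖ ≤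
      C * Real.exp (-(1 * phaseWeight t s z)) := by
  obtain ⟨C, hC, hle⟩ := ψ.exists_norm_gabor_le' ht hs φ (a := ρ + 1) (by positivity)
  refine ⟨C, hC, fun z => ?_⟩
  rw [norm_weightedGabor]
  calc Real.exp (ρ * phaseWeight t s z) * ‖gabor ψ φ z‖
      ≤ Real.exp (ρ * phaseWeight t s z) * (C * Real.exp (-((ρ + 1) * phaseWeight t s z))) := by
        gcongr; exact hle z
    _ = C * (Real.exp (ρ * phaseWeight t s z) * Real.exp (-((ρ + 1) * phaseWeight t s z))) := by
        ring
    _ = _ := by rw [← Real.exp_add]; ring_nf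

lemma GelfandShilov.memLp_weightedGabor (ht : 0 < t) (hs : 0 < s) {ρ : ℝ} (hρ : 0 ≤ ρ)
    (ψ φ : GelfandShilov d t s) : MemLp (weightedGabor t s ρ ψ φ) 2 := by
  obtain ⟨C, _, hle⟩ := ψ.exists_norm_weightedGabor_le ht hs hρ φ
  exact memLp_two_of_norm_le_exp ht hs (stronglyMeasurable_weightedGabor ht hs ρ ψ φ) hle

lemma gabor_add (ht : 0 < t) (ψ φ χ : GelfandShilov d t s) (z : Rd d × Rd d) :
    gabor ψ.1 (φ + χ).1 z = gabor ψ.1 φ.1 z + gabor ψ.1 χ.1 z := by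
  have : (φ + χ).1 = φ.1 + χ.1 := rfl
  unfold gabor
  rw [← integral_add (integrable_mul_conj_tfFun ht ψ φ z) (integrable_mul_conj_tfFun ht ψ χ z), this]
  simp only [Pi.add_apply, add_mul]

lemma gabor_smul (ψ φ : GelfandShilov d t s) (c : ℂ) (z : Rd d × Rd d) :
    gabor ψ.1 (c • φ).1 z = c * gabor ψ.1 φ.1 z := by
  have : (c • φ).1 = c • φ.1 := rfl
  unfold gabor
  rw [← integral_const_mul, this]
  simp only [Pi.smul_apply, smul_eq_mul, mul_assoc]

/-- The weighted Gabor transform as a linear map into `L²`. -/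
def weightedGaborL2 (ht : 0 < t) (hs : 0 < s) {ρ : ℝ} (hρ : 0 ≤ ρ) (ψ : GelfandShilov d t s) :
    GelfandShilov d t s →ₗ[ℂ] Lp ℂ 2 (volume : Measure (Rd d × Rd d)) where
  toFun φ := (ψ.memLp_weightedGabor ht hs hρ φ).toLp _
  map_add' φ χ := by
    rw [← MemLp.toLp_add]
    congr 1
    funext z
    simp only [weightedGabor, Pi.add_apply, gabor_add ht, mul_add]
  map_smul' c φ := by
    rw [RingHom.id_apply, ← MemLp.toLp_const_smul]
    congr 1
    funext z
    simp only [weightedGabor, Pi.smul_apply, smul_eq_mul, gabor_smul]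
    ring

/-- Bound for the norms of a test function by a weighted `L¹` norm of its Gabor transform. -/
lemma GelfandShilov.exists_gsBound_integral_gabor (ht : 0 < t) (hs : 0 < s)
    {ψ : GelfandShilov d t s} (hψ : ψ ≠ 0) {h : ℝ} (hh : 0 < h) :
    ∃ C r : ℝ, 0 ≤ C ∧ 0 ≤ r ∧ ∀ φ : GelfandShilov d t s,
      GSBound t s (C * ∫ z, ‖weightedGabor t s r ψ φ z‖) h h φ := by
  obtain ⟨C, r, hC, hr, hle⟩ := ψ.exists_gsBound_tfFun ht hs hh hh
  have hN := GelfandShilov.gaborConst_pos ht hψ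
  set N := gaborConst (ψ : Rd d → ℂ) with hNdef
  refine ⟨N⁻¹ * C, r, by positivity, hr, fun φ => ⟨φ.contDiff, fun α β y => ?_⟩⟩
  have hS := ψ.synthFamily_gabor ht hs φ
  -- By inversion, φ is a superposition of shifts of ψ; the factor e^{r(|x|^{1/t} + |ξ|^{1/s})} in
  -- the bounds for the shifts becomes the weight on the Gabor transform.
  have e : φ.1 = ((N⁻¹ : ℝ) : ℂ) • synth volume (gabor ψ φ) (tfFun ψ) := by
    funext y
    rw [Pi.smul_apply, ψ.synth_gabor ht hs, smul_eq_mul, ← mul_assoc, ← Complex.ofReal_mul,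
      inv_mul_cancel₀ hN.ne', Complex.ofReal_one, one_mul]
  obtain ⟨B, _, hB⟩ := ψ.exists_norm_weightedGabor_le ht hs hr φ
  have hint : Integrable fun z => ‖weightedGabor t s r ψ φ z‖ :=
    ((integrable_exp_neg_mul_phaseWeight ht hs one_pos).const_mul B).mono'
      (stronglyMeasurable_weightedGabor ht hs r ψ φ).norm.aestronglyMeasurable
      (Filter.Eventually.of_forall fun z => by rw [norm_norm]; exact hB z)
  set D := h ^ mlen α * h ^ mlen β * (mfact α : ℝ) ^ t * (mfact β : ℝ) ^ s with hD
  have h1 : |monom α y| * ‖synth volume (gabor ψ φ) (fun z => pderiv β (tfFun ψ z)) y‖ ≤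
      ∫ z, C * D * ‖weightedGabor t s r ψ φ z‖ := by
    have e1 : |monom α y| = ‖((monom α y : ℝ) : ℂ)‖ := by
      rw [Complex.norm_real, Real.norm_eq_abs]
    rw [e1, ← norm_mul, synth, ← integral_const_mul]
    refine norm_integral_le_of_norm_le (hint.const_mul _) (Filter.Eventually.of_forall fun z => ?_)
    rw [norm_mul, norm_mul, ← e1, norm_weightedGabor]
    have := (hle z).2 α β y
    calc |monom α y| * (‖gabor ψ φ z‖ * ‖pderiv β (tfFun ψ z) y‖)
        = ‖gabor ψ φ z‖ * (|monom α y| * ‖pderiv β (tfFun ψ z) y‖) := by ring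
      _ ≤ ‖gabor ψ φ z‖ * (C * Real.exp (r * phaseWeight t s z) * D) := by gcongr
      _ = _ := by ring
  rw [integral_const_mul] at h1
  calc |monom α y| * ‖pderiv β φ.1 y‖
      = N⁻¹ * (|monom α y| * ‖synth volume (gabor ψ φ) (fun z => pderiv β (tfFun ψ z)) y‖) := by
        have h2 : pderiv β φ.1 y = _ := congrArg (fun f => pderiv β f y) e
        rw [h2, pderiv_smul _ hS.contDiff_synth, Pi.smul_apply, norm_smul, Complex.norm_real,
          Real.norm_of_nonneg (by positivity), hS.pderiv_synth]
        ring
    _ ≤ N⁻¹ * (C * D * ∫ z, ‖weightedGabor t s r ψ φ z‖) := by gcongr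
    _ = _ := by ring

/-- Cauchy–Schwarz against e^{-(|x|^{1/t} + |ξ|^{1/s})}, which is square integrable. One unit of
weight is spent to reach a Hilbert space, where Riesz representation is available. -/
lemma integral_norm_weightedGabor_le (ht : 0 < t) (hs : 0 < s) (ψ : GelfandShilov d t s) {r : ℝ}
    (hr : 0 ≤ r) : ∃ K : ℝ, 0 ≤ K ∧ ∀ φ : GelfandShilov d t s,
      ∫ z, ‖weightedGabor t s r ψ φ z‖ ≤
        K * ‖weightedGaborL2 ht hs (by positivity : 0 ≤ r + 1) ψ φ‖ := by
  set w : Rd d × Rd d → ℂ := fun z => (Real.exp (-(1 * phaseWeight t s z)) : ℂ) with hw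
  have hwn : ∀ z, ‖w z‖ = Real.exp (-(1 * phaseWeight t s z)) := fun z => by
    rw [hw, Complex.norm_real, Real.norm_of_nonneg (Real.exp_pos _).le]
  have hwc : Continuous w := by
    have := (continuous_phaseWeight (d := d) ht hs)
    fun_prop
  have hwm : MemLp w 2 := memLp_two_of_norm_le_exp (C := 1) ht hs hwc.stronglyMeasurable
    fun z => by rw [hwn]; exact (one_mul _).ge
  refine ⟨(∫ z, ‖w z‖ ^ (2 : ℝ)) ^ (1 / (2 : ℝ)), by positivity, fun φ => ?_⟩
  have hm := ψ.memLp_weightedGabor ht hs (by positivity : 0 ≤ r + 1) φ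
  have h2 : ENNReal.ofReal (2 : ℝ) = 2 := by simp
  have h1 := integral_mul_norm_le_Lp_mul_Lq (p := 2) (q := 2) (μ := volume)
    Real.HolderConjugate.two_two (f := w) (g := weightedGabor t s (r + 1) ψ φ)
    (by rwa [h2]) (by rwa [h2])
  have e1 : ‖weightedGaborL2 ht hs (by positivity : 0 ≤ r + 1) ψ φ‖ =
      (∫ z, ‖weightedGabor t s (r + 1) ψ φ z‖ ^ (2 : ℝ)) ^ (1 / (2 : ℝ)) := by
    change ‖hm.toLp _‖ = _
    rw [Lp.norm_toLp, hm.eLpNorm_eq_integral_rpow_norm two_ne_zero ENNReal.ofNat_ne_top,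
      ENNReal.toReal_ofReal (by positivity)]
    simp
  rw [e1]
  refine le_trans (le_of_eq ?_) h1
  congr 1
  funext z
  rw [hwn, norm_weightedGabor, norm_weightedGabor, ← mul_assoc, ← Real.exp_add]
  ring_nf

/-- An ultradistribution is given by a function in the time-frequency plane. -/
theorem Ultradistribution.exists_eq_integral_conj_gabor (ht : 0 < t) (hs : 0 < s)
    {ψ : GelfandShilov d t s} (hψ : ψ ≠ 0) (u : Ultradistribution d t s) :
    ∃ (H : Rd d × Rd d → ℂ) (ρ : ℝ), 0 ≤ ρ ∧ StronglyMeasurable H ∧ MemLp H 2 ∧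
      ∀ φ : GelfandShilov d t s, u φ = ∫ z, H z * starRingEnd ℂ (weightedGabor t s ρ ψ φ z) := by
  obtain ⟨h, C, hh, hC, hu⟩ := u.exists_norm_le
  obtain ⟨C₁, r, hC₁, hr, hb⟩ := GelfandShilov.exists_gsBound_integral_gabor ht hs hψ hh
  obtain ⟨K, hK, hKle⟩ := integral_norm_weightedGabor_le ht hs ψ hr
  set T := weightedGaborL2 ht hs (by positivity : 0 ≤ r + 1) ψ with hT
  -- The conjugate of u, since u is conjugate linear and the representation lemma is for linear
  -- functionals.
  let v : GelfandShilov d t s →ₗ[ℂ] ℂ :=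
    { toFun := fun φ => starRingEnd ℂ (u φ)
      map_add' := fun φ χ => by rw [map_add, map_add]
      map_smul' := fun c φ => by simp }
  have hv : ∀ φ, ‖v φ‖ ≤ (C * C₁ * K) * ‖T φ‖ := by
    intro φ
    have h1 := hu φ _ (hb φ)
    have h2 := hKle φ
    have e : ‖v φ‖ = ‖u φ‖ := RCLike.norm_conj _
    rw [e]
    calc ‖u φ‖ ≤ C * (C₁ * ∫ z, ‖weightedGabor t s r ψ φ z‖) := h1
      _ ≤ C * (C₁ * (K * ‖T φ‖)) := by gcongr
      _ = _ := by ring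
  obtain ⟨H, hH⟩ := exists_inner_eq_of_norm_le T v hv
  refine ⟨H, r + 1, by positivity, Lp.stronglyMeasurable H, Lp.memLp H, fun φ => ?_⟩
  have h1 : starRingEnd ℂ (v φ) = u φ := Complex.conj_conj (u φ)
  rw [← h1, hH, L2.inner_def, ← integral_conj]
  refine integral_congr_ae ?_
  have h2 := (ψ.memLp_weightedGabor ht hs (by positivity : 0 ≤ r + 1) φ).coeFn_toLp
  filter_upwards [h2] with z hz
  have h3 : (T φ : Rd d × Rd d → ℂ) z = weightedGabor t s (r + 1) ψ φ z := hz
  rw [h3]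
  simp [RCLike.inner_apply, mul_comm]

/-! ### The reproducing formula for ultradistributions -/

lemma stronglyMeasurable_gabor_tfFun (ψ : GelfandShilov d t s) :
    StronglyMeasurable fun p : (Rd d × Rd d) × (Rd d × Rd d) => gabor ψ (tfFun ψ p.1) p.2 := by
  have hc := continuous_tfFun ψ.contDiff
  have h1 : Continuous fun q : ((Rd d × Rd d) × (Rd d × Rd d)) × Rd d => tfFun ψ q.1.1 q.2 :=
    hc.comp (f := fun q : ((Rd d × Rd d) × (Rd d × Rd d)) × Rd d => (q.1.1, q.2)) (by fun_prop)
  have h2 : Continuous fun q : ((Rd d × Rd d) × (Rd d × Rd d)) × Rd d => tfFun ψ q.1.2 q.2 :=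
    hc.comp (f := fun q : ((Rd d × Rd d) × (Rd d × Rd d)) × Rd d => (q.1.2, q.2)) (by fun_prop)
  have h3 := (h1.mul (Complex.continuous_conj.comp h2)).stronglyMeasurable.integral_prod_right'
    (ν := volume)
  exact h3

/-- The inversion formula for φ paired with the shift of ψ at w; Fubini is allowed because `gabor ψ
φ` and the shifted window are integrable and ψ is bounded. -/
lemma GelfandShilov.gabor_reproducing (ht : 0 < t) (hs : 0 < s) (ψ φ : GelfandShilov d t s)
    (w : Rd d × Rd d) :
    (gaborConst ψ.1 : ℂ) * gabor ψ φ w = ∫ z, gabor ψ φ z * gabor ψ (tfFun ψ z) w := by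
  obtain ⟨B, hB, hBle⟩ := ψ.exists_norm_le_const ht
  have hc := continuous_tfFun ψ.contDiff
  have hV := ψ.integrable_gabor ht hs φ
  have hψw : Integrable fun y => starRingEnd ℂ (tfFun ψ w y) := by
    refine ((ψ.integrable ht).comp_sub_right w.1).norm.mono'
      (Complex.continuous_conj.comp (hc.comp
        (continuous_const.prodMk continuous_id))).aestronglyMeasurable
      (Filter.Eventually.of_forall fun y => ?_)
    rw [RCLike.norm_conj, norm_tfFun]
  have hint : Integrable (Function.uncurry fun (y : Rd d) (z : Rd d × Rd d) =>
      gabor ψ φ z * tfFun ψ z y * starRingEnd ℂ (tfFun ψ w y)) (volume.prod volume) := by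
    refine ((hψw.norm.const_mul B).mul_prod hV.norm).mono' ?_
      (Filter.Eventually.of_forall fun p => ?_)
    · refine StronglyMeasurable.aestronglyMeasurable ?_
      refine StronglyMeasurable.mul (StronglyMeasurable.mul ?_ ?_) ?_
      · exact (stronglyMeasurable_gabor ψ.contDiff φ.contDiff.continuous).comp_measurable
          measurable_snd
      · exact (hc.comp (continuous_snd.prodMk continuous_fst)).stronglyMeasurable
      · exact (Complex.continuous_conj.comp
          (hc.comp (continuous_const.prodMk continuous_fst))).stronglyMeasurable
    · simp only [Function.uncurry, norm_mul]
      have := hBle (p.1 - p.2.1)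
      rw [norm_tfFun _ p.2]
      calc ‖gabor ψ φ p.2‖ * ‖ψ.1 (p.1 - p.2.1)‖ * ‖starRingEnd ℂ (tfFun ψ w p.1)‖
          ≤ ‖gabor ψ φ p.2‖ * B * ‖starRingEnd ℂ (tfFun ψ w p.1)‖ := by gcongr
        _ = _ := by ring
  calc (gaborConst ψ.1 : ℂ) * gabor ψ φ w
      = ∫ y, ∫ z, gabor ψ φ z * tfFun ψ z y * starRingEnd ℂ (tfFun ψ w y) := by
        rw [gabor, ← integral_const_mul]
        congr 1
        funext y
        rw [integral_mul_const, ← mul_assoc, ← ψ.synth_gabor ht hs φ y]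
        rfl
    _ = ∫ z, ∫ y, gabor ψ φ z * tfFun ψ z y * starRingEnd ℂ (tfFun ψ w y) :=
        integral_integral_swap hint
    _ = _ := by
        congr 1
        funext z
        rw [gabor.eq_def ψ.1 (tfFun ψ z) w, ← integral_const_mul]
        simp only [mul_assoc]

/-- The function `z ↦ (u, M_ξ T_x ψ)` is measurable and determines `u`. -/
theorem Ultradistribution.integral_conj_gabor_mul (ht : 0 < t) (hs : 0 < s)
    {ψ : GelfandShilov d t s} (hψ : ψ ≠ 0) (u : Ultradistribution d t s) :
    StronglyMeasurable (fun z : Rd d × Rd d => u (tfShift ht hs z.1 z.2 ψ)) ∧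
    ∀ φ : GelfandShilov d t s, (gaborConst ψ.1 : ℂ) * u φ =
      ∫ z, starRingEnd ℂ (gabor ψ φ z) * u (tfShift ht hs z.1 z.2 ψ) := by
  obtain ⟨H, ρ, hρ, hHm, hH2, hH⟩ := u.exists_eq_integral_conj_gabor ht hs hψ
  have hwt := continuous_exp_mul_phaseWeight (d := d) ht hs ρ
  have hker : StronglyMeasurable fun p : (Rd d × Rd d) × (Rd d × Rd d) =>
      H p.2 * starRingEnd ℂ (weightedGabor t s ρ ψ (tfFun ψ p.1) p.2) := by
    refine (hHm.comp_measurable measurable_snd).mul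
      (Complex.continuous_conj.comp_stronglyMeasurable (StronglyMeasurable.mul ?_ ?_))
    · exact (Complex.continuous_ofReal.comp (hwt.comp continuous_snd)).stronglyMeasurable
    · exact stronglyMeasurable_gabor_tfFun ψ
  have hu : (fun z : Rd d × Rd d => u (tfShift ht hs z.1 z.2 ψ)) = fun z =>
      ∫ w, H w * starRingEnd ℂ (weightedGabor t s ρ ψ (tfFun ψ z) w) :=
    funext fun z => hH (tfShift ht hs z.1 z.2 ψ)
  refine ⟨by rw [hu]; exact hker.integral_prod_right', fun φ => ?_⟩
  have hVm := stronglyMeasurable_gabor ψ.contDiff φ.contDiff.continuous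
  -- absolute convergence of the double integral
  obtain ⟨h, k, C, hh, hk, hC, hg⟩ := ψ.exists_norm_gabor_le ht hs (a := ρ + 1) (by positivity)
  obtain ⟨C₁, r, hC₁, hr, hb⟩ := ψ.exists_gsBound_tfFun ht hs hh hk
  have hVr : Integrable fun z => ‖weightedGabor t s r ψ φ z‖ := by
    obtain ⟨B, _, hB⟩ := ψ.exists_norm_weightedGabor_le ht hs hr φ
    exact ((integrable_exp_neg_mul_phaseWeight ht hs one_pos).const_mul B).mono'
      (stronglyMeasurable_weightedGabor ht hs r ψ φ).norm.aestronglyMeasurable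
      (Filter.Eventually.of_forall fun z => by rw [norm_norm]; exact hB z)
  have hHi : Integrable fun w => ‖H w‖ * Real.exp (-(1 * phaseWeight t s w)) := by
    have hwc : Continuous fun w : Rd d × Rd d => (Real.exp (-(1 * phaseWeight t s w)) : ℂ) := by
      have := (continuous_phaseWeight (d := d) ht hs)
      fun_prop
    have hwm := memLp_two_of_norm_le_exp (C := 1) ht hs hwc.stronglyMeasurable fun z => by
      rw [Complex.norm_real, Real.norm_of_nonneg (Real.exp_pos _).le]
      exact (one_mul _).ge
    refine (hH2.integrable_mul hwm).norm.congr (Filter.Eventually.of_forall fun z => ?_)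
    simp only [Pi.mul_apply, norm_mul]
    rw [Complex.norm_real, Real.norm_of_nonneg (Real.exp_pos _).le]
  have hint : Integrable (Function.uncurry fun (w z : Rd d × Rd d) =>
      starRingEnd ℂ (gabor ψ φ z) *
        (H w * starRingEnd ℂ (weightedGabor t s ρ ψ (tfFun ψ z) w))) (volume.prod volume) := by
    refine ((hHi.const_mul (C * C₁)).mul_prod hVr).mono' ?_ (Filter.Eventually.of_forall fun p => ?_)
    · refine StronglyMeasurable.aestronglyMeasurable (StronglyMeasurable.mul ?_ ?_)
      · exact Complex.continuous_conj.comp_stronglyMeasurable (hVm.comp_measurable measurable_snd)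
      · exact hker.comp_measurable measurable_swap
    · obtain ⟨w, z⟩ := p
      simp only [Function.uncurry, norm_mul, RCLike.norm_conj, norm_weightedGabor]
      have h1 := hg _ _ (hb z) w
      calc ‖gabor ψ φ z‖ * (‖H w‖ * (Real.exp (ρ * phaseWeight t s w) * ‖gabor ψ (tfFun ψ z) w‖))
          ≤ ‖gabor ψ φ z‖ * (‖H w‖ * (Real.exp (ρ * phaseWeight t s w) *
            (C * (C₁ * Real.exp (r * phaseWeight t s z)) *
              Real.exp (-((ρ + 1) * phaseWeight t s w))))) := by gcongr
        _ = C * C₁ * (‖H w‖ * (Real.exp (ρ * phaseWeight t s w) *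
            Real.exp (-((ρ + 1) * phaseWeight t s w)))) *
            (Real.exp (r * phaseWeight t s z) * ‖gabor ψ φ z‖) := by ring
        _ = _ := by
          rw [← Real.exp_add]
          ring_nf
  calc (gaborConst ψ.1 : ℂ) * u φ
      = ∫ w, ∫ z, starRingEnd ℂ (gabor ψ φ z) *
          (H w * starRingEnd ℂ (weightedGabor t s ρ ψ (tfFun ψ z) w)) := by
        rw [hH, ← integral_const_mul]
        congr 1
        funext w
        -- The reproducing formula expands the Gabor transform of φ at w over shifts z. After the
        -- exchange of integrals, the inner integral over w is the representation of u applied to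
        -- the shift of ψ at z.
        have h1 := congrArg (starRingEnd ℂ) (ψ.gabor_reproducing ht hs φ w)
        rw [map_mul, Complex.conj_ofReal, ← integral_conj] at h1
        simp only [weightedGabor, map_mul, Complex.conj_ofReal]
        calc (gaborConst ψ.1 : ℂ) * (H w * ((Real.exp (ρ * phaseWeight t s w) : ℂ) *
              starRingEnd ℂ (gabor ψ φ w)))
            = H w * (Real.exp (ρ * phaseWeight t s w) : ℂ) *
              ((gaborConst ψ.1 : ℂ) * starRingEnd ℂ (gabor ψ φ w)) := by ring
          _ = _ := by
            rw [h1, ← integral_const_mul]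
            congr 1
            funext z
            rw [map_mul]
            ring
    _ = ∫ z, ∫ w, starRingEnd ℂ (gabor ψ φ z) *
          (H w * starRingEnd ℂ (weightedGabor t s ρ ψ (tfFun ψ z) w)) :=
        integral_integral_swap hint
    _ = _ := by
        congr 1
        funext z
        rw [integral_const_mul, congrFun hu z]

/-! ### The wave front set condition -/

lemma Ultradistribution.exists_norm_tfShift_le (ht : 0 < t) (hs : 0 < s)
    (ψ : GelfandShilov d t s) (u : Ultradistribution d t s) :
    ∃ C r : ℝ, 0 ≤ C ∧ 0 ≤ r ∧ ∀ z : Rd d × Rd d,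
      ‖u (tfShift ht hs z.1 z.2 ψ)‖ ≤ C * Real.exp (r * phaseWeight t s z) := by
  obtain ⟨h, C, hh, hC, hu⟩ := u.exists_norm_le
  obtain ⟨C₁, r, hC₁, hr, hb⟩ := ψ.exists_gsBound_tfFun ht hs hh hh
  refine ⟨C * C₁, r, by positivity, hr, fun z => ?_⟩
  rw [mul_assoc]
  exact hu _ _ (hb z)

/-- Compactness of the unit sphere in ξ: each point (0, ξ₀) has a product neighbourhood inside its
set U, and finitely many suffice. As U is chosen before r, a single ε serves all r; only C depends
on r. -/
lemma exists_stft_bound_on_sphere (ht : 0 < t) (hs : 0 < s) (ψ : GelfandShilov d t s)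
    (u : Ultradistribution d t s) (hWF : waveFrontSet ht hs ψ u ∩ ({0} ×ˢ {0}ᶜ) = ∅) :
    ∃ ε : ℝ, 0 < ε ∧ ∀ r : ℝ, 0 < r → ∃ C : ℝ, ∀ lam : ℝ, 0 < lam → ∀ x : Rd d, ‖x‖ < ε →
      ∀ ξ ∈ Metric.sphere (0 : Rd d) 1,
        Real.exp (r * lam) * ‖stft ht hs ψ u (lam ^ t • x) (lam ^ s • ξ)‖ ≤ C := by
  refine (isCompact_sphere (0 : Rd d) 1).induction_on
    (p := fun S => ∃ ε : ℝ, 0 < ε ∧ ∀ r : ℝ, 0 < r → ∃ C : ℝ, ∀ lam : ℝ, 0 < lam → ∀ x : Rd d,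
      ‖x‖ < ε → ∀ ξ ∈ S, Real.exp (r * lam) * ‖stft ht hs ψ u (lam ^ t • x) (lam ^ s • ξ)‖ ≤ C)
    ⟨1, one_pos, fun r _ => ⟨0, by simp⟩⟩ ?_ ?_ ?_
  · rintro S S' hSS' ⟨ε, hε, H⟩
    refine ⟨ε, hε, fun r hr => ?_⟩
    obtain ⟨C, hC⟩ := H r hr
    exact ⟨C, fun lam hl x hx ξ hξ => hC lam hl x hx ξ (hSS' hξ)⟩
  · rintro S S' ⟨ε, hε, H⟩ ⟨ε', hε', H'⟩
    refine ⟨min ε ε', lt_min hε hε', fun r hr => ?_⟩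
    obtain ⟨C, hC⟩ := H r hr
    obtain ⟨C', hC'⟩ := H' r hr
    refine ⟨max C C', fun lam hl x hx ξ hξ => ?_⟩
    rcases hξ with hξ | hξ
    · exact (hC lam hl x (hx.trans_le (min_le_left _ _)) ξ hξ).trans (le_max_left _ _)
    · exact (hC' lam hl x (hx.trans_le (min_le_right _ _)) ξ hξ).trans (le_max_right _ _)
  · intro ξ₀ hξ₀
    have hξ₀' : ξ₀ ≠ 0 := by
      rintro rfl
      simp at hξ₀
    have h1 : ((0 : Rd d), ξ₀) ∉ waveFrontSet ht hs ψ u := fun hmem => by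
      have : ((0 : Rd d), ξ₀) ∈ waveFrontSet ht hs ψ u ∩ ({0} ×ˢ {0}ᶜ) := ⟨hmem, by simpa using hξ₀'⟩
      rw [hWF] at this
      exact this
    have h2 : ((0 : Rd d), ξ₀) ≠ 0 := fun h => hξ₀' (congrArg Prod.snd h)
    simp only [waveFrontSet, Set.mem_ofPred_eq, not_and, not_not] at h1
    obtain ⟨U, hU, -, hmem, H⟩ := h1 h2
    obtain ⟨ε, hε, hball⟩ := Metric.isOpen_iff.1 hU _ hmem
    refine ⟨Metric.ball ξ₀ ε, mem_nhdsWithin_of_mem_nhds (Metric.ball_mem_nhds _ hε), ε, hε,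
      fun r hr => ?_⟩
    obtain ⟨C, hC⟩ := H r hr
    refine ⟨C, fun lam hl x hx ξ hξ => hC lam hl (x, ξ) (hball ?_)⟩
    rw [← ball_prod_same]
    exact ⟨by simpa using hx, hξ⟩

/-- If the wave front set does not meet `{0} × (ℝ^d ∖ 0)` then `(u, M_ξ T_x ψ)` has arbitrary
exponential decay in frequency, at the expense of exponential growth in space. -/
theorem exists_norm_tfShift_le_of_waveFrontSet (ht : 0 < t) (hs : 0 < s) (ψ : GelfandShilov d t s)
    (u : Ultradistribution d t s) (hWF : waveFrontSet ht hs ψ u ∩ ({0} ×ˢ {0}ᶜ) = ∅) {r : ℝ}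
    (hr : 0 < r) : ∃ C R : ℝ, 0 ≤ R ∧ ∀ z : Rd d × Rd d, ‖u (tfShift ht hs z.1 z.2 ψ)‖ ≤
      C * (Real.exp (-(r * ‖z.2‖ ^ (1 / s))) * Real.exp (R * ‖z.1‖ ^ (1 / t))) := by
  obtain ⟨C₀, r₀, hC₀, hr₀, hgrow⟩ := u.exists_norm_tfShift_le ht hs ψ
  obtain ⟨ε, hε, H⟩ := exists_stft_bound_on_sphere ht hs ψ u hWF
  obtain ⟨C₁, hC₁⟩ := H r hr
  set c : ℝ := (2 * Real.pi) ^ (-(d : ℝ) / 2) with hc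
  have hc0 : 0 < c := by positivity
  set K : ℝ := (1 / ε) ^ (1 / t) with hK
  have hK0 : 0 ≤ K := by positivity
  have hR : 0 ≤ r₀ + (r₀ + r) * K := by positivity
  -- Here c is the normalisation of the transform, and K is the constant in |ξ|^{1/s} ≤ K|x|^{1/t},
  -- valid where the wave front estimate does not apply. There r₀(|x|^{1/t} + |ξ|^{1/s}) +
  -- r|ξ|^{1/s} ≤ (r₀ + (r₀ + r)K)|x|^{1/t}.
  refine ⟨|C₁| / c + C₀, r₀ + (r₀ + r) * K, hR, fun z => ?_⟩
  obtain ⟨x, ξ⟩ := z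
  simp only
  set X := ‖x‖ ^ (1 / t) with hX
  set lam := ‖ξ‖ ^ (1 / s) with hlam
  have hX0 : 0 ≤ X := by positivity
  have hlam0 : 0 ≤ lam := by positivity
  -- With λ = |ξ|^{1/s}, the rescaled frequency λ^{-s} ξ is a unit vector when ξ ≠ 0. The first case
  -- says that λ^{-t} x has norm below ε, which also forces ξ ≠ 0.
  rcases lt_or_ge ‖x‖ (ε * lam ^ t) with h | h
  · have hlp : 0 < lam := by
      refine lt_of_le_of_ne hlam0 fun h0 => ?_
      rw [← h0, Real.zero_rpow ht.ne', mul_zero] at h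
      exact absurd h (not_lt.2 (norm_nonneg _))
    have hls : lam ^ s = ‖ξ‖ := by
      rw [hlam, ← Real.rpow_mul (norm_nonneg _), one_div_mul_cancel hs.ne', Real.rpow_one]
    have hξp : 0 < ‖ξ‖ := by rw [← hls]; positivity
    have hlt : 0 < lam ^ t := by positivity
    have h1 := hC₁ lam hlp ((lam ^ t)⁻¹ • x)
      (by rw [norm_smul, Real.norm_of_nonneg (by positivity), ← div_eq_inv_mul, div_lt_iff₀ hlt]
          exact h)
      (‖ξ‖⁻¹ • ξ) (by
        rw [mem_sphere_zero_iff_norm, norm_smul, norm_inv, norm_norm, inv_mul_cancel₀ hξp.ne'])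
    rw [hls, smul_inv_smul₀ hlt.ne', smul_inv_smul₀ hξp.ne', stft, norm_mul, Complex.norm_real,
      Real.norm_of_nonneg hc0.le] at h1
    have h2 : ‖u (tfShift ht hs x ξ ψ)‖ ≤ |C₁| / c * Real.exp (-(r * lam)) := by
      rw [Real.exp_neg, ← div_eq_mul_inv, le_div_iff₀ (Real.exp_pos _), le_div_iff₀ hc0]
      calc _ = Real.exp (r * lam) * (c * ‖u (tfShift ht hs x ξ ψ)‖) := by ring
        _ ≤ |C₁| := h1.trans (le_abs_self _)
    have h3 : 1 ≤ Real.exp ((r₀ + (r₀ + r) * K) * X) := Real.one_le_exp (by positivity)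
    calc ‖u (tfShift ht hs x ξ ψ)‖ ≤ |C₁| / c * Real.exp (-(r * lam)) := h2
      _ ≤ (|C₁| / c + C₀) * (Real.exp (-(r * lam)) * 1) := by
        rw [mul_one]
        gcongr
        linarith
      _ ≤ _ := by gcongr
  · have h1 : lam ≤ K * X := by
      have h2 : lam ^ t ≤ 1 / ε * ‖x‖ := by
        rw [one_div, ← div_eq_inv_mul, le_div_iff₀ hε]; linarith
      have h3 := Real.rpow_le_rpow (by positivity) h2 (by positivity : 0 ≤ 1 / t)
      rwa [← Real.rpow_mul hlam0, mul_one_div_cancel ht.ne', Real.rpow_one,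
        Real.mul_rpow (by positivity) (norm_nonneg _)] at h3
    have h2 := hgrow (x, ξ)
    simp only [phaseWeight] at h2
    rw [← Real.exp_add]
    have h4 : r₀ * (X + lam) ≤ -(r * lam) + (r₀ + (r₀ + r) * K) * X := by
      have := mul_le_mul_of_nonneg_left h1 (by positivity : 0 ≤ r₀ + r)
      linarith
    have h5 : 0 ≤ |C₁| / c := by positivity
    calc ‖u (tfShift ht hs x ξ ψ)‖ ≤ C₀ * Real.exp (r₀ * (X + lam)) := h2
      _ ≤ (|C₁| / c + C₀) * Real.exp (-(r * lam) + (r₀ + (r₀ + r) * K) * X) := by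
        gcongr
        linarith

/-- If `(u, M_ξ T_x ψ)` decays in frequency then the inversion formula defines a function that
represents `u`. -/
theorem isGivenBy_synth (ht : 0 < t) (hs : 0 < s) {ψ : GelfandShilov d t s} (hψ : ψ ≠ 0)
    (u : Ultradistribution d t s) {C₁ C₂ r : ℝ} (hC₁ : 0 ≤ C₁)
    (hS : SynthFamily volume (fun z : Rd d × Rd d => u (tfShift ht hs z.1 z.2 ψ)) (tfFun ψ))
    (h₁ : ∀ z y, ‖u (tfShift ht hs z.1 z.2 ψ)‖ * ‖tfFun ψ z y‖ ≤
      C₁ * Real.exp (r * ‖y‖ ^ (1 / t)) * Real.exp (-(1 * phaseWeight t s z)))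
    (h₂ : ∀ y, ‖synth volume (fun z => u (tfShift ht hs z.1 z.2 ψ)) (tfFun ψ) y‖ ≤
      C₂ * Real.exp (r * ‖y‖ ^ (1 / t))) (hr : 0 ≤ r) :
    IsGivenBy u (((gaborConst ψ.1)⁻¹ : ℂ) •
      synth volume (fun z => u (tfShift ht hs z.1 z.2 ψ)) (tfFun ψ)) := by
  intro φ
  have hN := GelfandShilov.gaborConst_pos ht hψ
  have hNc : (gaborConst ψ.1 : ℂ) ≠ 0 := by exact_mod_cast hN.ne'
  obtain ⟨hGm, hrep⟩ := u.integral_conj_gabor_mul ht hs hψ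
  set G : Rd d × Rd d → ℂ := fun z => u (tfShift ht hs z.1 z.2 ψ) with hG
  set F := synth volume G (tfFun ψ) with hF
  -- Test functions decay at every rate; r + 1 overcomes the growth e^{r|y|^{1/t}} of the
  -- synthesized function and leaves an integrable factor.
  obtain ⟨B, hB, hBle⟩ := φ.exists_norm_le ht (a := r + 1) (by positivity)
  have hφc : Continuous fun y => starRingEnd ℂ (φ.1 y) :=
    Complex.continuous_conj.comp φ.contDiff.continuous
  have hexp : ∀ y : Rd d, Real.exp (r * ‖y‖ ^ (1 / t)) * Real.exp (-((r + 1) * ‖y‖ ^ (1 / t))) =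
      Real.exp (-(1 * ‖y‖ ^ (1 / t))) := fun y => by
    rw [← Real.exp_add]; ring_nf
  have hI := integrable_exp_neg_mul_norm_rpow (d := d) one_pos (one_div_pos.2 ht)
  have hFi : Integrable fun y => F y * starRingEnd ℂ (φ.1 y) := by
    refine (hI.const_mul (C₂ * B)).mono'
      (hS.contDiff_synth.continuous.mul hφc).aestronglyMeasurable
      (Filter.Eventually.of_forall fun y => ?_)
    rw [norm_mul, RCLike.norm_conj, ← hexp]
    calc ‖F y‖ * ‖φ.1 y‖ ≤ (C₂ * Real.exp (r * ‖y‖ ^ (1 / t))) *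
          (B * Real.exp (-((r + 1) * ‖y‖ ^ (1 / t)))) :=
          mul_le_mul (h₂ y) (hBle y) (norm_nonneg _) ((norm_nonneg _).trans (h₂ y))
      _ = _ := by ring
  have hint : Integrable (Function.uncurry fun (y : Rd d) (z : Rd d × Rd d) =>
      G z * tfFun ψ z y * starRingEnd ℂ (φ.1 y)) (volume.prod volume) := by
    have hIz := integrable_exp_neg_mul_phaseWeight (d := d) ht hs one_pos
    refine ((hI.const_mul (C₁ * B)).mul_prod hIz).mono' ?_
      (Filter.Eventually.of_forall fun p => ?_)
    · refine StronglyMeasurable.aestronglyMeasurable (((hGm.comp_measurable measurable_snd).mul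
        ?_).mul (hφc.comp continuous_fst).stronglyMeasurable)
      exact ((continuous_tfFun ψ.contDiff).comp
        (continuous_snd.prodMk continuous_fst)).stronglyMeasurable
    · simp only [Function.uncurry, norm_mul, RCLike.norm_conj]
      rw [← hexp]
      calc ‖G p.2‖ * ‖tfFun ψ p.2 p.1‖ * ‖φ.1 p.1‖
          ≤ (C₁ * Real.exp (r * ‖p.1‖ ^ (1 / t)) * Real.exp (-(1 * phaseWeight t s p.2))) *
            (B * Real.exp (-((r + 1) * ‖p.1‖ ^ (1 / t)))) :=
            mul_le_mul (h₁ p.2 p.1) (hBle p.1) (norm_nonneg _) (by positivity)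
        _ = _ := by ring
  have h1 : ∫ z, starRingEnd ℂ (gabor ψ φ z) * G z = ∫ y, F y * starRingEnd ℂ (φ.1 y) :=
    calc ∫ z, starRingEnd ℂ (gabor ψ φ z) * G z
        = ∫ z, ∫ y, G z * tfFun ψ z y * starRingEnd ℂ (φ.1 y) := by
          congr 1
          funext z
          rw [gabor, ← integral_conj, ← integral_mul_const]
          congr 1
          funext y
          rw [map_mul, Complex.conj_conj]
          ring
      _ = ∫ y, ∫ z, G z * tfFun ψ z y * starRingEnd ℂ (φ.1 y) := (integral_integral_swap hint).symm
      _ = _ := by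
          congr 1
          funext y
          rw [integral_mul_const]
          rfl
  simp only [Pi.smul_apply, smul_eq_mul, mul_assoc]
  refine ⟨hFi.const_mul _, ?_⟩
  rw [integral_const_mul, ← h1, ← hrep φ, inv_mul_cancel_left₀ hNc]

end GS

end

/-! ### Smoothness of the ultradistribution and bounds for its derivatives -/

theorem proposition5p4 (d : ℕ) (t s : ℝ) (ht : 0 < t) (hs : 0 < s) (hst : 1 < s + t)
    (ψ : GS.GelfandShilov d t s) (hψ : ψ ≠ 0) (u : GS.Ultradistribution d t s)
    (hWF : GS.waveFrontSet ht hs ψ u ∩ ({0} ×ˢ {0}ᶜ) = ∅) :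
    ∃ f : GS.Rd d → ℂ, ContDiff ℝ ∞ f ∧ GS.IsGivenBy u f ∧
      ∃ C r : ℝ, 0 < C ∧ 0 < r ∧ ∀ (x : GS.Rd d) (α : Fin d → ℕ),
        ‖GS.pderiv α f x‖ ≤
          C ^ (1 + GS.mlen α) * (GS.mfact α : ℝ) ^ s * Real.exp (r * ‖x‖ ^ (1 / t)) := by
  have hN := GS.GelfandShilov.gaborConst_pos ht hψ
  obtain ⟨hGm, -⟩ := u.integral_conj_gabor_mul ht hs hψ
  obtain ⟨C, R, hR, hG⟩ := GS.exists_norm_tfShift_le_of_waveFrontSet ht hs ψ u hWF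
    -- Of the decay at all rates, only this one is needed: one more than the growth rate s d of the
    -- derivatives of M_ξ T_x ψ in frequency.
    (r := s * d + 1) (by positivity)
  obtain ⟨hS, C₁, C₂, r, hC₁, hC₂, hr, h₁, h₂⟩ :=
    GS.synth_tfFun ht hs ψ hGm.aestronglyMeasurable hR hG
  refine ⟨((GS.gaborConst ψ.1)⁻¹ : ℂ) • GS.synth MeasureTheory.volume
    (fun z => u (GS.tfShift ht hs z.1 z.2 ψ)) (GS.tfFun ψ), contDiff_const.smul hS.contDiff_synth, GS.isGivenBy_synth ht hs hψ u (C₂ := C₂) hC₁ hS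
    h₁ (fun y => ?_) hr.le, ?_⟩
  · simpa [GS.mlen_zero, GS.mfact_zero, GS.pderiv_zero] using h₂ 0 y
  set N := GS.gaborConst (ψ : GS.Rd d → ℂ) with hNdef
  -- One factor M takes the constant in front and the other |α| factors take (2^d)^{|α|}, which
  -- matches the power 1 + |α|.
  set M : ℝ := max (N⁻¹ * C₂) (2 ^ d) with hM
  have hM0 : 0 < M := lt_max_of_lt_right (by positivity)
  refine ⟨M, r, hM0, hr, fun y α => ?_⟩
  have h3 := GS.pderiv_smul (N : ℂ)⁻¹ hS.contDiff_synth α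
  rw [h3, Pi.smul_apply, norm_smul, norm_inv, Complex.norm_real, Real.norm_of_nonneg hN.le]
  calc _ ≤ N⁻¹ * (C₂ * ((2 ^ d) ^ GS.mlen α * (GS.mfact α : ℝ) ^ s) *
        Real.exp (r * ‖y‖ ^ (1 / t))) := by gcongr; exact h₂ α y
    _ = (N⁻¹ * C₂) * (2 ^ d) ^ GS.mlen α * (GS.mfact α : ℝ) ^ s *
        Real.exp (r * ‖y‖ ^ (1 / t)) := by ring
    _ ≤ M * M ^ GS.mlen α * (GS.mfact α : ℝ) ^ s * Real.exp (r * ‖y‖ ^ (1 / t)) := by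
        gcongr
        · exact le_max_left _ _
        · exact le_max_right _ _
    _ = _ := by rw [pow_add, pow_one]
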